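/- **Theorem (Fractional Dirichlet-to-Neumann map).** Let $n\ge 3$, let $\mathbb S^{n-1}$ be the unit sphere of $\mathbb R^n$ with surface measure $d\mathcal H^{n-1}$ and geodesic distance $d(x,y)=\arccos(x\cdot y)$, and put $\omega_{n-1}=2\pi^{n/2}/\Gamma(n/2)$. For $k\ge 0$ let $SH^k$ be the space of real spherical harmonics of degree $k$ (restrictions to $\mathbb S^{n-1}$ of harmonic homogeneous polynomials of degree $k$), let $\{Y_{k,l}\}_l$ be any $L^2(\mathbb S^{n-1})$-orthonormal basis of $SH^k$, and let $P_ku=\sum_l\big(\int_{\mathbb S^{n-1}}u\,Y_{k,l}\,d\mathcal H^{n-1}\big)Y_{k,l}$. Let $L$ be the Dirichlet-to-Neumann operator of the unit ball, $Lu=\sum_{k\ge0}k\,P_ku$, so that for $a>0$ $$\big(L+\tfrac{n-2}{2}\big)^{a}u(x)=\sum_{k=0}^\infty\big(k+\tfrac{n-2}{2}\big)^{a}P_ku(x).$$ Let $P_r(\tau)=\dfrac{1-r^2}{\omega_{n-1}(1-2r\tau+r^2)^{n/2}}$ be the Poisson kernel of the unit ball. Let $0<2s<1$ and define $$L_{2s}(x\cdot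 y)=\frac{1}{|\Gamma(-2s)|}\int_0^\infty e^{-t\frac{n-2}{2}}P_{e^{-t}}(x\cdot y)\,\frac{dt}{t^{1+2s}}.$$ 1. For every real function $u\in C^\infty(\mathbb S^{n-1})$ and every $x\in\mathbb S^{n-1}$, the series defining $(L+\frac{n-2}{2})^{2s}u(x)$ converges absolutely and $$\big(L+\tfrac{n-2}{2}\big)^{2s}u(x)=\int_{\mathbb S^{n-1}}(u(x)-u(y))\,L_{2s}(x\cdot y)\,d\mathcal H^{n-1}(y)+\big(\tfrac{n-2}{2}\big)^{2s}u(x),$$ where the integral over the sphere is absolutely convergent. 2. There are constants $c,C>0$ depending only on $n$ and $s$ such that for all $x\ne y$ in $\mathbb S^{n-1}$ the integral defining $L_{2s}(x\cdot y)$ converges and $$\frac{c}{d(x,y)^{(n-1)+2s}}\le L_{2s}(x\cdot y)\le\frac{C}{d(x,y)^{(n-1)+2s}}.$$ -/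

import Mathlib

namespace SphereDtN

noncomputable section

open MeasureTheory

/-- The unit sphere of `ℝⁿ` (the sphere usually written with exponent `n - 1`). -/
abbrev Sph (n : ℕ) : Type := Metric.sphere (0 : EuclideanSpace ℝ (Fin n)) 1

/-- The surface measure of the unit sphere of `ℝⁿ`, i.e. the normalized `(n-1)`-dimensional Hausdorff
measure on it. Mathlib builds it from polar coordinates: the area of `A` is `n` times the Lebesgue
measure of the cone `{r x : 0 < r < 1, x ∈ A}`; the total mass is `2 π^(n/2) / Γ(n/2)`. -/
abbrev surf (n : ℕ) : Measure (Sph n) :=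
  (volume : Measure (EuclideanSpace ℝ (Fin n))).toSphere

/-- The dot product of two points of the sphere. -/
def dot {n : ℕ} (x y : Sph n) : ℝ :=
  inner ℝ (x : EuclideanSpace ℝ (Fin n)) (y : EuclideanSpace ℝ (Fin n))

/-- The geodesic distance on the sphere. -/
def geoDist {n : ℕ} (x y : Sph n) : ℝ := Real.arccos (dot x y)

/-- The extension of `u` along the normal lines of the sphere: `X ↦ u (X / |X|)` for `X ≠ 0`
(the value at the origin is irrelevant and set to `0`). -/
def radialExt {n : ℕ} (u : Sph n → ℝ) (X : EuclideanSpace ℝ (Fin n)) : ℝ :=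
  if h : X = 0 then 0
  else u ⟨‖X‖⁻¹ • X, by simp [norm_smul, h]⟩

/-- `u` is a smooth function on the sphere: its extension along normal lines is smooth on a
neighbourhood of the sphere. -/
def SmoothOnSphere {n : ℕ} (u : Sph n → ℝ) : Prop :=
  ∃ U : Set (EuclideanSpace ℝ (Fin n)), IsOpen U ∧
    Metric.sphere (0 : EuclideanSpace ℝ (Fin n)) 1 ⊆ U ∧
    ContDiffOn ℝ (⊤ : ℕ∞) (radialExt u) U

/-- The Laplacian `∑ i, ∂ᵢ²` on real polynomials in `n` variables. -/
def polyLaplacian (n : ℕ) : MvPolynomial (Fin n) ℝ →ₗ[ℝ] MvPolynomial (Fin n) ℝ :=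
  ∑ i : Fin n, (MvPolynomial.pderiv i).toLinearMap ∘ₗ (MvPolynomial.pderiv i).toLinearMap

/-- Restriction of a polynomial to the sphere. -/
def restrictToSphere (n : ℕ) : MvPolynomial (Fin n) ℝ →ₗ[ℝ] (Sph n → ℝ) where
  toFun p := fun x => MvPolynomial.eval (fun i => (x : EuclideanSpace ℝ (Fin n)) i) p
  map_add' p q := by ext x; simp
  map_smul' c p := by ext x; simp [MvPolynomial.smul_eval]

/-- The space of (real) spherical harmonics of degree `k`: restrictions to the sphere of the harmonic
homogeneous polynomials of degree `k`. -/
def SH (n k : ℕ) : Submodule ℝ (Sph n → ℝ) :=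
  (MvPolynomial.homogeneousSubmodule (Fin n) ℝ k ⊓ LinearMap.ker (polyLaplacian n)).map
    (restrictToSphere n)

/-- For every degree `k`, a basis `Y k l` of the space of spherical harmonics of degree `k` that is
orthonormal in `L²` of the sphere. -/
structure SHBasis (n : ℕ) where
  /-- the basis functions -/
  Y : (k : ℕ) → Fin (Module.finrank ℝ (SH n k)) → Sph n → ℝ
  span_eq : ∀ k, Submodule.span ℝ (Set.range (Y k)) = SH n k
  orthonormal : ∀ k l l', ∫ x, Y k l x * Y k l' x ∂(surf n) = if l = l' then 1 else 0

/-- The coefficient `c_{k,l}(u) = ∫ u Y_{k,l}`. -/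
def SHBasis.coeff {n : ℕ} (B : SHBasis n) (k : ℕ) (l : Fin (Module.finrank ℝ (SH n k)))
    (u : Sph n → ℝ) : ℝ :=
  ∫ y, u y * B.Y k l y ∂(surf n)

/-- The projection `P_k u = ∑ l, c_{k,l}(u) Y_{k,l}` onto the spherical harmonics of degree `k`. -/
def SHBasis.proj {n : ℕ} (B : SHBasis n) (k : ℕ) (u : Sph n → ℝ) (x : Sph n) : ℝ :=
  ∑ l, B.coeff k l u * B.Y k l x

/-- The `k`-th term `(k + (n-2)/2)^a P_k u(x)` of the series defining `(L + (n-2)/2)^a u(x)`; here `L`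
is the Dirichlet-to-Neumann operator, which acts on spherical harmonics of degree `k` as `k`. -/
def SHBasis.dtnTerm {n : ℕ} (B : SHBasis n) (a : ℝ) (u : Sph n → ℝ) (x : Sph n) (k : ℕ) : ℝ :=
  ((k : ℝ) + ((n : ℝ) - 2) / 2) ^ a * B.proj k u x

/-- The fractional power `(L + (n-2)/2)^a u(x)` of the Dirichlet-to-Neumann operator. -/
def SHBasis.fracDtN {n : ℕ} (B : SHBasis n) (a : ℝ) (u : Sph n → ℝ) (x : Sph n) : ℝ :=
  ∑' k : ℕ, B.dtnTerm a u x k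

/-- The surface area `2 π^(n/2) / Γ(n/2)` of the unit sphere of `ℝⁿ`. -/
def sphereArea (n : ℕ) : ℝ := 2 * Real.pi ^ ((n : ℝ) / 2) / Real.Gamma ((n : ℝ) / 2)

/-- The Poisson kernel `P_r(τ)` of the unit ball of `ℝⁿ`. -/
def poisson (n : ℕ) (r τ : ℝ) : ℝ :=
  (1 - r ^ 2) / (sphereArea n * (1 - 2 * r * τ + r ^ 2) ^ ((n : ℝ) / 2))

/-- The integrand `e^{-t(n-2)/2} P_{e^{-t}}(τ) t^{-1-a}`. -/
def kernelIntegrand (n : ℕ) (a τ t : ℝ) : ℝ :=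
  Real.exp (-t * (((n : ℝ) - 2) / 2)) * poisson n (Real.exp (-t)) τ / t ^ (1 + a)

/-- The kernel `L_a(τ) = |Γ(-a)|⁻¹ ∫_0^∞ e^{-t(n-2)/2} P_{e^{-t}}(τ) t^{-1-a} dt`. -/
def kernelL (n : ℕ) (a τ : ℝ) : ℝ :=
  1 / |Real.Gamma (-a)| * ∫ t in Set.Ioi (0 : ℝ), kernelIntegrand n a τ t

/-! Orthonormal bases of spherical harmonics exist. -/

theorem continuous_of_mem_SH {n k : ℕ} {f : Sph n → ℝ} (hf : f ∈ SH n k) : Continuous f := by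
  obtain ⟨p, -, rfl⟩ := hf
  change Continuous fun x : Sph n => MvPolynomial.eval (fun i => (x : EuclideanSpace ℝ (Fin n)) i) p
  have h := MvPolynomial.continuous_eval p
  exact h.comp (by fun_prop)

theorem integrable_of_continuous {n : ℕ} {f : Sph n → ℝ} (hf : Continuous f) :
    Integrable f (surf n) :=
  hf.integrable_of_hasCompactSupport (HasCompactSupport.of_compactSpace f)

theorem finite_SH (n k : ℕ) : Module.Finite ℝ (SH n k) := by
  have h : Module.Finite ℝ (MvPolynomial.homogeneousSubmodule (Fin n) ℝ k) :=
    Module.Finite.iff_fg.2 (MvPolynomial.homogeneousSubmodule_fg ..)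
  have h2 : Module.Finite ℝ ↥(MvPolynomial.homogeneousSubmodule (Fin n) ℝ k ⊓
      LinearMap.ker (polyLaplacian n)) :=
    Submodule.finiteDimensional_of_le inf_le_left
  exact Module.Finite.map _ _

/-- The `L²` inner product on the spherical harmonics of degree `k`. -/
@[reducible] def coreSH (n k : ℕ) : InnerProductSpace.Core ℝ (SH n k) where
  inner f g := ∫ x, f.1 x * g.1 x ∂(surf n)
  conj_inner_symm f g := by simp [mul_comm]
  re_inner_nonneg f := by
    simpa using integral_nonneg (μ := surf n) (fun x => mul_self_nonneg (f.1 x))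
  add_left f g h := by
    have hf := continuous_of_mem_SH f.2
    have hg := continuous_of_mem_SH g.2
    have hh := continuous_of_mem_SH h.2
    simp only [Submodule.coe_add, Pi.add_apply, add_mul]
    exact integral_add (integrable_of_continuous (hf.mul hh))
      (integrable_of_continuous (hg.mul hh))
  smul_left f g c := by
    simp [mul_assoc, integral_const_mul]
  definite f h := by
    have hf := continuous_of_mem_SH f.2
    have h1 := (integral_eq_zero_iff_of_nonneg (μ := surf n) (fun x => mul_self_nonneg (f.1 x))
      (integrable_of_continuous (hf.mul hf))).1 h
    have h2 := (Continuous.ae_eq_iff_eq (surf n) (hf.mul hf) continuous_zero).1 h1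
    ext x
    simpa using congrFun h2 x

theorem nonempty_SHBasis (n : ℕ) : Nonempty (SHBasis n) := by
  have key : ∀ k, ∃ Y : Fin (Module.finrank ℝ (SH n k)) → Sph n → ℝ,
      Submodule.span ℝ (Set.range Y) = SH n k ∧
      ∀ l l', ∫ x, Y l x * Y l' x ∂(surf n) = if l = l' then 1 else 0 := by
    intro k
    let _ : NormedAddCommGroup (SH n k) := (coreSH n k).toNormedAddCommGroup
    let _ : InnerProductSpace ℝ (SH n k) := InnerProductSpace.ofCore (coreSH n k).toCore
    have : FiniteDimensional ℝ (SH n k) := finite_SH n k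
    let b := stdOrthonormalBasis ℝ (SH n k)
    refine ⟨fun l => (b l : Sph n → ℝ), ?_, ?_⟩
    · have h1 : Submodule.span ℝ (Set.range b) = ⊤ := by
        simpa using b.toBasis.span_eq
      have h2 := congrArg (Submodule.map (SH n k).subtype) h1
      rw [Submodule.map_span, Submodule.map_top, Submodule.range_subtype, ← Set.range_comp] at h2
      exact h2
    · intro l l'
      exact (orthonormal_iff_ite.1 b.orthonormal) l l'
  choose Y h1 h2 using key
  exact ⟨⟨Y, h1, h2⟩⟩

end

end SphereDtN

/-! Write m = (n-2)/2, a = 2s, ω for the area of the sphere, τ = x·y. The function `heat` is the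
kernel of the semigroup e^{-t(L+m)}: it acts on spherical harmonics of degree k as e^{-(k+m)t}
(`integral_mul_heat`). Given this, the scalar formula λ^a |Γ(-a)| = ∫ (1 - e^{-λt}) t^{-1-a} dt
(`integral_one_sub_exp_div`), taken at λ = k + m and summed against P_k u, yields |Γ(-a)| (L+m)^a
u(x) = ∫ (u(x) - e^{-t(L+m)}u(x)) t^{-1-a} dt. Since `heat` has mass e^{-mt}, the numerator is ∫
(u(x) - u(y)) heat dy + (1 - e^{-mt}) u(x). The second term produces m^a u(x); Fubini turns the
first into the integral against L_a.

The eigenvalue comes from an ordinary differential equation. With r = e^{-t}, `newton` is r^m |rx -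
y|^{2-n}, and harmonicity in logarithmic polar coordinates says (∂_t² + Δ - m²) newton = 0, where Δ
is the spherical Laplacian; moreover ∂_t newton = -mω heat. Integrating against a harmonic p of
degree k, with Δp = -k(k+n-2)p, gives G'' = (k+m)² G. Boundedness as t → ∞ leaves only the decaying
exponential, and the constant is found from heat being an approximate identity as t → 0. Here Δ is
half the sum of squares of the rotation fields, self-adjoint because rotations preserve the surface
measure.

The expansion u = Σ P_k u uses completeness (harmonic decomposition of polynomials and
Stone-Weierstrass) and decay of P_k u: a sup bound polynomial in k, obtained from the semigroup at
time 1/(k+1), is beaten by applying Δ n times.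

For the kernel bounds let δ = |x - y|. Then heat is at most of order t δ^{-n} for t ≤ δ and t^{1-n}
+ t^{2-n} for all t, and comparable with δ^{1-n} for δ ≤ t ≤ 2δ; integrating in t gives δ^{1-n-a}.
The same comparison at exponent a - 1 < 0 justifies Fubini: |u(x) - u(y)| ≤ Kδ bounds the integrand
by the kernel of exponent a - 1, whose integral over the sphere is ∫ e^{-mt} t^{-a} dt. -/

namespace SphereDtN

noncomputable section

open MeasureTheory Metric Filter Topology
open scoped ContDiff

/-! ### Rotations of the sphere and integration by parts -/

section Rotation

open scoped Pointwise

/-- A linear isometry of the ambient space, acting on the sphere. -/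
def sphMap {n : ℕ} (R : EuclideanSpace ℝ (Fin n) ≃ₗᵢ[ℝ] EuclideanSpace ℝ (Fin n)) (x : Sph n) :
    Sph n :=
  ⟨R x, by simp⟩

theorem continuous_sphMap {n : ℕ}
    (R : EuclideanSpace ℝ (Fin n) ≃ₗᵢ[ℝ] EuclideanSpace ℝ (Fin n)) : Continuous (sphMap R) := by
  unfold sphMap
  exact (R.continuous.comp continuous_subtype_val).subtype_mk _

/-- The area of a set is defined by the volume of the cone over it; an isometry pulls cones back to
cones and preserves volume. -/
theorem measurePreserving_sphMap {n : ℕ}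
    (R : EuclideanSpace ℝ (Fin n) ≃ₗᵢ[ℝ] EuclideanSpace ℝ (Fin n)) :
    MeasurePreserving (sphMap R) (surf n) (surf n) := by
  refine ⟨(continuous_sphMap R).measurable, ?_⟩
  ext A hA
  rw [Measure.map_apply (continuous_sphMap R).measurable hA,
    Measure.toSphere_apply' _ ((continuous_sphMap R).measurable hA), Measure.toSphere_apply' _ hA]
  congr 1
  have h : (Set.Ioo (0 : ℝ) 1 • ((↑) '' (sphMap R ⁻¹' A)) : Set (EuclideanSpace ℝ (Fin n))) =
      R ⁻¹' (Set.Ioo (0 : ℝ) 1 • ((↑) '' A)) := by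
    ext z
    simp only [Set.mem_smul, Set.mem_preimage, Set.mem_image]
    constructor
    · rintro ⟨r, hr, _, ⟨y, hy, rfl⟩, rfl⟩
      exact ⟨r, hr, _, ⟨sphMap R y, hy, rfl⟩, by simp [sphMap]⟩
    · rintro ⟨r, hr, _, ⟨y, hy, rfl⟩, h⟩
      refine ⟨r, hr, R.symm y, ⟨sphMap R.symm y, ?_, rfl⟩, ?_⟩
      · have : sphMap R (sphMap R.symm y) = y := by ext1; simp [sphMap]
        rwa [this]
      · rw [← map_smul, h, R.symm_apply_apply]
  rw [h, R.measurePreserving.measure_preimage_emb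
    R.toHomeomorph.toMeasurableEquiv.measurableEmbedding]

theorem integral_comp_sphMap {n : ℕ}
    (R : EuclideanSpace ℝ (Fin n) ≃ₗᵢ[ℝ] EuclideanSpace ℝ (Fin n)) {f : Sph n → ℝ}
    (hf : Continuous f) : ∫ x, f (sphMap R x) ∂(surf n) = ∫ x, f x ∂(surf n) := by
  rw [← integral_map (continuous_sphMap R).measurable.aemeasurable hf.aestronglyMeasurable,
    (measurePreserving_sphMap R).map_eq]

/-- The velocity field `x ↦ x_i e_j - x_j e_i` of the rotations in the `(i, j)`-plane. -/
def rotVec {n : ℕ} (i j : Fin n) : EuclideanSpace ℝ (Fin n) →L[ℝ] EuclideanSpace ℝ (Fin n) :=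
  (EuclideanSpace.proj i : EuclideanSpace ℝ (Fin n) →L[ℝ] ℝ).smulRight (EuclideanSpace.single j 1) -
    (EuclideanSpace.proj j : EuclideanSpace ℝ (Fin n) →L[ℝ] ℝ).smulRight
      (EuclideanSpace.single i 1)

theorem rotVec_apply {n : ℕ} (i j : Fin n) (x : EuclideanSpace ℝ (Fin n)) (l : Fin n) :
    rotVec i j x l = x i * (if l = j then 1 else 0) - x j * (if l = i then 1 else 0) := by
  simp [rotVec]

/-- The rotation by the angle `θ` in the `(i, j)`-plane, as a continuous linear map. -/
def rotCLM {n : ℕ} (i j : Fin n) (θ : ℝ) :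
    EuclideanSpace ℝ (Fin n) →L[ℝ] EuclideanSpace ℝ (Fin n) :=
  ContinuousLinearMap.id ℝ _ + (1 - Real.cos θ) • (rotVec i j ∘L rotVec i j) +
    Real.sin θ • rotVec i j

/-- On the (i, j)-plane the field J is a quarter turn, elsewhere it is zero. The relation sums the
exponential series to exp(θJ) = 1 + (1 - cos θ) J² + sin θ J, the form used for `rotCLM`. -/
theorem rotVec_cube {n : ℕ} {i j : Fin n} (h : i ≠ j) (x : EuclideanSpace ℝ (Fin n)) :
    rotVec i j (rotVec i j (rotVec i j x)) = - rotVec i j x := by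
  ext l
  simp only [rotVec_apply, PiLp.neg_apply]
  simp only [h, h.symm, if_true, if_false]
  ring

theorem inner_rotVec {n : ℕ} (i j : Fin n) (x y : EuclideanSpace ℝ (Fin n)) :
    inner ℝ (rotVec i j x) y = x i * y j - x j * y i := by
  simp [rotVec, inner_sub_left, inner_smul_left, EuclideanSpace.inner_single_left]

theorem inner_rotVec_antisymm {n : ℕ} (i j : Fin n) (x y : EuclideanSpace ℝ (Fin n)) :
    inner ℝ (rotVec i j x) y = - inner ℝ x (rotVec i j y) := by
  rw [real_inner_comm (rotVec i j y) x, inner_rotVec, inner_rotVec]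
  ring

theorem norm_rotCLM {n : ℕ} {i j : Fin n} (h : i ≠ j) (θ : ℝ) (x : EuclideanSpace ℝ (Fin n)) :
    ‖rotCLM i j θ x‖ = ‖x‖ := by
  have h1 : inner ℝ (rotVec i j x) x = 0 := by rw [inner_rotVec]; ring
  have h2 : inner ℝ (rotVec i j (rotVec i j x)) x = - inner ℝ (rotVec i j x) (rotVec i j x) :=
    inner_rotVec_antisymm _ _ _ _
  have h3 : inner ℝ (rotVec i j (rotVec i j x)) (rotVec i j x) = 0 := by
    rw [inner_rotVec]; ring
  have h4 : inner ℝ (rotVec i j (rotVec i j x)) (rotVec i j (rotVec i j x)) =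
      inner ℝ (rotVec i j x) (rotVec i j x) := by
    rw [inner_rotVec_antisymm, rotVec_cube h, inner_neg_right, neg_neg]
  have key : inner ℝ (rotCLM i j θ x) (rotCLM i j θ x) = inner ℝ x x := by
    simp only [rotCLM, add_apply, smul_apply,
      ContinuousLinearMap.id_apply, ContinuousLinearMap.comp_apply, inner_add_left, inner_add_right,
      inner_smul_left, inner_smul_right, RCLike.conj_to_real]
    rw [← real_inner_comm x (rotVec i j x), ← real_inner_comm x (rotVec i j (rotVec i j x)),
      real_inner_comm (rotVec i j (rotVec i j x)) (rotVec i j x)]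
    rw [h1, h2, h3, h4]
    linear_combination (inner ℝ (rotVec i j x) (rotVec i j x) : ℝ) * Real.sin_sq_add_cos_sq θ
  rw [real_inner_self_eq_norm_sq, real_inner_self_eq_norm_sq] at key
  exact (sq_eq_sq₀ (norm_nonneg _) (norm_nonneg _)).1 key

/-- The rotation by the angle `θ` in the `(i, j)`-plane. -/
def rot {n : ℕ} {i j : Fin n} (h : i ≠ j) (θ : ℝ) :
    EuclideanSpace ℝ (Fin n) ≃ₗᵢ[ℝ] EuclideanSpace ℝ (Fin n) :=
  LinearIsometry.toLinearIsometryEquiv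
    ⟨(rotCLM i j θ).toLinearMap, fun x => norm_rotCLM h θ x⟩ rfl

theorem rot_apply {n : ℕ} {i j : Fin n} (h : i ≠ j) (θ : ℝ) (x : EuclideanSpace ℝ (Fin n)) :
    rot h θ x = x + (1 - Real.cos θ) • rotVec i j (rotVec i j x) + Real.sin θ • rotVec i j x :=
  rfl

theorem hasDerivAt_rot {n : ℕ} {i j : Fin n} (h : i ≠ j) (θ : ℝ) (x : EuclideanSpace ℝ (Fin n)) :
    HasDerivAt (fun θ => rot h θ x) (rotVec i j (rot h θ x)) θ := by
  have h1 := (((Real.hasDerivAt_cos θ).const_sub 1).smul_const (rotVec i j (rotVec i j x))).const_add x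
  have h2 := h1.add ((Real.hasDerivAt_sin θ).smul_const (rotVec i j x))
  refine (h2.congr_deriv ?_)
  rw [rot_apply, map_add, map_add, map_smul, map_smul, rotVec_cube h]
  module

/-- A function on the ambient space that is smooth at every point of the unit sphere. -/
def SmoothNear {n : ℕ} (f : EuclideanSpace ℝ (Fin n) → ℝ) : Prop :=
  ∀ x ∈ sphere (0 : EuclideanSpace ℝ (Fin n)) 1, ContDiffAt ℝ ∞ f x

/-- The derivative along the rotations in the `(i, j)`-plane. -/
def rotDeriv {n : ℕ} (i j : Fin n) (f : EuclideanSpace ℝ (Fin n) → ℝ)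
    (x : EuclideanSpace ℝ (Fin n)) : ℝ :=
  fderiv ℝ f x (rotVec i j x)

variable {n : ℕ} {f g : EuclideanSpace ℝ (Fin n) → ℝ}

theorem SmoothNear.rotDeriv (hf : SmoothNear f) (i j : Fin n) :
    SmoothNear (rotDeriv i j f) := fun x hx =>
  ((hf x hx).fderiv_right (m := ∞) (by simp)).clm_apply (rotVec i j).contDiff.contDiffAt

theorem SmoothNear.mul (hf : SmoothNear f) (hg : SmoothNear g) : SmoothNear (fun x => f x * g x) :=
  fun x hx => (hf x hx).mul (hg x hx)

theorem SmoothNear.differentiableAt (hf : SmoothNear f) (x : Sph n) :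
    DifferentiableAt ℝ f x :=
  (hf x x.2).differentiableAt (by simp)

theorem SmoothNear.continuous (hf : SmoothNear f) : Continuous (fun x : Sph n => f x) :=
  continuous_iff_continuousAt.2 fun x =>
    ((hf x x.2).continuousAt).comp continuous_subtype_val.continuousAt

/-- By invariance of the measure the integral of f ∘ R_θ does not depend on θ; its derivative at θ =
0 is the integral in question. -/
theorem integral_rotDeriv (hf : SmoothNear f) (i j : Fin n) :
    ∫ x : Sph n, rotDeriv i j f x ∂(surf n) = 0 := by
  rcases eq_or_ne i j with rfl | h
  · simp [rotDeriv, rotVec]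
  have hc := (hf.rotDeriv i j).continuous
  obtain ⟨C, hC⟩ := isCompact_univ.exists_bound_of_continuousOn hc.continuousOn
  have hr : ∀ θ, Continuous fun x : Sph n => f (sphMap (rot h θ) x) := fun θ =>
    hf.continuous.comp (continuous_sphMap (rot h θ))
  have key := (hasDerivAt_integral_of_dominated_loc_of_deriv_le (μ := surf n) (𝕜 := ℝ)
    (F := fun θ (x : Sph n) => f (sphMap (rot h θ) x))
    (F' := fun θ (x : Sph n) => rotDeriv i j f (sphMap (rot h θ) x)) (x₀ := 0)
    (bound := fun _ => C) (s := Set.univ) Filter.univ_mem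
    (.of_forall fun θ => (hr θ).aestronglyMeasurable)
    (integrable_of_continuous (hr 0))
    ((hc.comp (continuous_sphMap (rot h 0))).aestronglyMeasurable)
    (.of_forall fun x θ _ => hC _ trivial) (integrable_const _)
    (.of_forall fun x θ _ => by
      have h1 := (hf.differentiableAt (sphMap (rot h θ) x)).hasFDerivAt
      exact h1.comp_hasDerivAt θ (hasDerivAt_rot h θ x))).2
  simp only [integral_comp_sphMap _ hf.continuous, integral_comp_sphMap _ hc] at key
  exact key.unique (hasDerivAt_const _ _)

theorem rotDeriv_mul (i j : Fin n) (hf : SmoothNear f) (hg : SmoothNear g) (x : Sph n) :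
    rotDeriv i j (fun x => f x * g x) x = rotDeriv i j f x * g x + f x * rotDeriv i j g x := by
  unfold rotDeriv
  rw [fderiv_fun_mul (hf.differentiableAt x) (hg.differentiableAt x)]
  simp
  ring

theorem integral_rotDeriv_mul (i j : Fin n) (hf : SmoothNear f) (hg : SmoothNear g) :
    ∫ x : Sph n, rotDeriv i j f x * g x ∂(surf n) =
      - ∫ x : Sph n, f x * rotDeriv i j g x ∂(surf n) := by
  have h := integral_rotDeriv (hf.mul hg) i j
  simp only [rotDeriv_mul i j hf hg] at h
  rw [integral_add (integrable_of_continuous ((hf.rotDeriv i j).mul hg).continuous)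
    (integrable_of_continuous (hf.mul (hg.rotDeriv i j)).continuous)] at h
  linarith

/-- The Laplace-Beltrami operator of the sphere, as half the sum of the squares of all
rotation derivatives. -/
def sphLap (f : EuclideanSpace ℝ (Fin n) → ℝ) (x : EuclideanSpace ℝ (Fin n)) : ℝ :=
  (∑ i, ∑ j, rotDeriv i j (rotDeriv i j f) x) / 2

theorem SmoothNear.sphLap (hf : SmoothNear f) : SmoothNear (sphLap f) := fun x hx =>
  ContDiffAt.div_const (ContDiffAt.sum fun i _ => ContDiffAt.sum fun j _ =>
    ((hf.rotDeriv i j).rotDeriv i j) x hx) _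

theorem integral_sphLap_mul (hf : SmoothNear f) (hg : SmoothNear g) :
    ∫ x : Sph n, sphLap f x * g x ∂(surf n) = ∫ x : Sph n, f x * sphLap g x ∂(surf n) := by
  have h1 : ∀ x : Sph n, sphLap f x * g x =
      (∑ i, ∑ j, rotDeriv i j (rotDeriv i j f) x * g x) / 2 := fun x => by
    simp only [SphereDtN.sphLap, ← Finset.sum_mul]; ring
  have h2 : ∀ x : Sph n, f x * sphLap g x =
      (∑ i, ∑ j, f x * rotDeriv i j (rotDeriv i j g) x) / 2 := fun x => by
    simp only [SphereDtN.sphLap, ← Finset.mul_sum]; ring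
  simp only [h1, h2, integral_div]
  congr 1
  rw [integral_finsetSum _ fun i _ => integrable_finsetSum _ fun j _ => integrable_of_continuous
      (((hf.rotDeriv i j).rotDeriv i j).mul hg).continuous,
    integral_finsetSum _ fun i _ => integrable_finsetSum _ fun j _ => integrable_of_continuous
      (hf.mul ((hg.rotDeriv i j).rotDeriv i j)).continuous]
  refine Finset.sum_congr rfl fun i _ => ?_
  rw [integral_finsetSum _ fun j _ => integrable_of_continuous
      (((hf.rotDeriv i j).rotDeriv i j).mul hg).continuous,
    integral_finsetSum _ fun j _ => integrable_of_continuous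
      (hf.mul ((hg.rotDeriv i j).rotDeriv i j)).continuous]
  refine Finset.sum_congr rfl fun j _ => ?_
  rw [integral_rotDeriv_mul i j (hf.rotDeriv i j) hg,
    integral_rotDeriv_mul i j hf (hg.rotDeriv i j), neg_neg]

end Rotation

theorem integrable_mul_of_continuous {n : ℕ} {f g : Sph n → ℝ} (hf : Continuous f)
    (hg : Continuous g) : Integrable (fun x => f x * g x) (surf n) :=
  integrable_of_continuous (hf.mul hg)

/-! ### Harmonic polynomials: eigenvalues, decomposition, completeness -/

section Polynomial

open MvPolynomial

variable {n : ℕ}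

/-- A polynomial as a function on the ambient space. -/
def polyFun (p : MvPolynomial (Fin n) ℝ) (x : EuclideanSpace ℝ (Fin n)) : ℝ :=
  eval (fun i => x i) p

theorem restrictToSphere_apply (p : MvPolynomial (Fin n) ℝ) (x : Sph n) :
    restrictToSphere n p x = polyFun p x := rfl

theorem contDiff_polyFun (p : MvPolynomial (Fin n) ℝ) : ContDiff ℝ ∞ (polyFun p) := by
  unfold polyFun
  induction p using MvPolynomial.induction_on with
  | C a => simpa using contDiff_const
  | add p q hp hq => simpa using hp.add hq
  | mul_X p i hp =>
    simp only [map_mul, eval_X]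
    exact hp.mul (EuclideanSpace.proj i : EuclideanSpace ℝ (Fin n) →L[ℝ] ℝ).contDiff

theorem smoothNear_polyFun (p : MvPolynomial (Fin n) ℝ) : SmoothNear (polyFun p) :=
  fun _ _ => (contDiff_polyFun p).contDiffAt

theorem fderiv_polyFun (p : MvPolynomial (Fin n) ℝ) (x v : EuclideanSpace ℝ (Fin n)) :
    fderiv ℝ (polyFun p) x v = ∑ i, v i * polyFun (pderiv i p) x := by
  have hd : ∀ p : MvPolynomial (Fin n) ℝ, DifferentiableAt ℝ (polyFun p) x := fun p =>
    (contDiff_polyFun p).contDiffAt.differentiableAt (by simp)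
  induction p using MvPolynomial.induction_on with
  | C a =>
    have : polyFun (C a : MvPolynomial (Fin n) ℝ) = fun _ => a := by ext x; simp [polyFun]
    rw [this]
    simp [polyFun]
  | add p q hp hq =>
    have : polyFun (p + q) = fun x => polyFun p x + polyFun q x := by ext x; simp [polyFun]
    rw [this, fderiv_fun_add (hd p) (hd q), add_apply, hp, hq, ← Finset.sum_add_distrib]
    refine Finset.sum_congr rfl fun i _ => ?_
    simp [polyFun]
    ring
  | mul_X p j hp =>
    have : polyFun (p * X j) = fun x => polyFun p x *
        (EuclideanSpace.proj j : EuclideanSpace ℝ (Fin n) →L[ℝ] ℝ) x := by ext x; simp [polyFun]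
    rw [this, fderiv_fun_mul (hd p) (ContinuousLinearMap.differentiableAt _), add_apply,
      smul_apply, smul_apply, hp, ContinuousLinearMap.fderiv]
    simp only [polyFun, pderiv_mul, pderiv_X, map_add, map_mul, eval_X, smul_eq_mul,
      PiLp.proj_apply, mul_add, Finset.sum_add_distrib]
    rw [add_comm, Finset.mul_sum]
    congr 1
    · exact Finset.sum_congr rfl fun i _ => by ring
    · rw [Finset.sum_eq_single j]
      · simp; ring
      · intro i _ hi
        simp [hi.symm]
      · simp

/-- The rotation derivative on polynomials. -/
def polyRot (i j : Fin n) (p : MvPolynomial (Fin n) ℝ) : MvPolynomial (Fin n) ℝ :=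
  X i * pderiv j p - X j * pderiv i p

theorem rotDeriv_polyFun (i j : Fin n) (p : MvPolynomial (Fin n) ℝ) :
    rotDeriv i j (polyFun p) = polyFun (polyRot i j p) := by
  ext x
  rw [rotDeriv, fderiv_polyFun]
  simp only [rotVec_apply, sub_mul, Finset.sum_sub_distrib]
  simp [polyFun, polyRot]

theorem polyLaplacian_apply (p : MvPolynomial (Fin n) ℝ) :
    polyLaplacian n p = ∑ i, pderiv i (pderiv i p) := by
  simp [polyLaplacian]

/-- The polynomial `|X|²`. -/
def normSqPoly (n : ℕ) : MvPolynomial (Fin n) ℝ := ∑ i, X i ^ 2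

theorem pderiv_X_eq_ite (i j : Fin n) :
    pderiv i (X j : MvPolynomial (Fin n) ℝ) = if i = j then 1 else 0 := by
  rw [pderiv_X, Pi.single_apply]
  simp only [eq_comm]

/-- Second-order Euler identity, from applying the Euler operator Σ X_i ∂_i to Euler's identity. -/
theorem sum_sum_X_mul_pderiv {k : ℕ} {p : MvPolynomial (Fin n) ℝ} (hp : p.IsHomogeneous k) :
    ∑ i, ∑ j, X i * X j * pderiv i (pderiv j p) = ((k : MvPolynomial (Fin n) ℝ) ^ 2 - k) * p := by
  have h1 := hp.sum_X_mul_pderiv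
  rw [nsmul_eq_mul] at h1
  have h2 : ∀ i : Fin n, X i * pderiv i (∑ j, X j * pderiv j p) =
      X i * pderiv i p + ∑ j, X i * X j * pderiv i (pderiv j p) := by
    intro i
    simp only [map_sum, pderiv_mul, pderiv_X_eq_ite, Finset.sum_add_distrib, mul_add,
      Finset.mul_sum]
    simp [mul_assoc]
  have h3 := Finset.sum_congr (s₁ := Finset.univ) rfl fun i (_ : i ∈ Finset.univ) => h2 i
  rw [Finset.sum_add_distrib, h1] at h3
  have h4 : ∀ i : Fin n, X i * pderiv i ((k : MvPolynomial (Fin n) ℝ) * p) =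
      (k : MvPolynomial (Fin n) ℝ) * (X i * pderiv i p) := by
    intro i
    have : pderiv i (k : MvPolynomial (Fin n) ℝ) = 0 := Derivation.map_natCast _ _
    rw [pderiv_mul, this]; ring
  simp only [h4, ← Finset.mul_sum, h1] at h3
  linear_combination -h3

/-- Casimir identity: with E the Euler operator, the sum of (X_i ∂_j - X_j ∂_i)² is 2(|X|² Δ - E² -
(n-2)E), and E acts as k in degree k. -/
theorem sum_polyRot_polyRot {k : ℕ} {p : MvPolynomial (Fin n) ℝ} (hp : p.IsHomogeneous k) :
    ∑ i, ∑ j, polyRot i j (polyRot i j p) =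
      2 * (normSqPoly n * polyLaplacian n p - (k : MvPolynomial (Fin n) ℝ) * (k + n - 2) * p) := by
  have h1 := hp.sum_X_mul_pderiv
  rw [nsmul_eq_mul] at h1
  have h2 := sum_sum_X_mul_pderiv hp
  have h2' : ∑ i, ∑ j, X i * X j * pderiv j (pderiv i p) =
      ((k : MvPolynomial (Fin n) ℝ) ^ 2 - k) * p := by
    rw [Finset.sum_comm, ← h2]
    exact Finset.sum_congr rfl fun i _ => Finset.sum_congr rfl fun j _ => by ring
  have h3 : ∀ i j : Fin n, polyRot i j (polyRot i j p) =
      X i * (if i = j then pderiv j p else 0) + X i ^ 2 * pderiv j (pderiv j p) - X i * pderiv i p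
      - X i * X j * pderiv j (pderiv i p) - X j * pderiv j p - X i * X j * pderiv i (pderiv j p)
      + X j * (if i = j then pderiv i p else 0) + X j ^ 2 * pderiv i (pderiv i p) := by
    intro i j
    simp only [polyRot, map_sub, pderiv_mul, pderiv_X_eq_ite]
    rcases eq_or_ne i j with rfl | h
    · simp; ring
    · simp [h, h.symm]; ring
  simp only [h3, Finset.sum_add_distrib, Finset.sum_sub_distrib, h2, h2', mul_ite, mul_zero,
    Finset.sum_ite_eq, Finset.mem_univ, if_true, h1, Finset.sum_const, Finset.card_univ,
    Fintype.card_fin, nsmul_eq_mul, ← Finset.mul_sum, ← Finset.sum_mul]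
  rw [← polyLaplacian_apply, ← normSqPoly]
  ring

/-- Harmonic homogeneous polynomials of degree `k` are eigenfunctions of the spherical Laplacian. -/
theorem sphLap_polyFun {k : ℕ} {p : MvPolynomial (Fin n) ℝ} (hp : p.IsHomogeneous k)
    (h : polyLaplacian n p = 0) (x : EuclideanSpace ℝ (Fin n)) :
    sphLap (polyFun p) x = -((k : ℝ) * (k + n - 2)) * polyFun p x := by
  have h1 := congrArg (fun q => polyFun q x) (sum_polyRot_polyRot hp)
  rw [h] at h1
  simp only [sphLap, rotDeriv_polyFun]
  simp only [polyFun, map_sum, map_mul, map_sub, map_add, map_natCast, mul_zero, zero_sub,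
    map_ofNat, map_neg] at h1 ⊢
  rw [h1]
  ring

/-- Product rule: Δ|X|² = 2n, and the cross term 2∇|X|²·∇q is 4 times Euler's operator on q. -/
theorem polyLaplacian_normSqPoly_mul {d : ℕ} {q : MvPolynomial (Fin n) ℝ}
    (hq : q.IsHomogeneous d) : polyLaplacian n (normSqPoly n * q) =
      normSqPoly n * polyLaplacian n q + (4 * d + 2 * n) * q := by
  have h1 := hq.sum_X_mul_pderiv
  rw [nsmul_eq_mul] at h1
  have h2 : ∀ i, pderiv i (normSqPoly n) = 2 * X i := by
    intro i
    simp only [normSqPoly, map_sum, pderiv_pow, pderiv_X_eq_ite]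
    simp
  have h3 : ∀ i, pderiv i (pderiv i (normSqPoly n * q)) =
      2 * q + 4 * (X i * pderiv i q) + normSqPoly n * pderiv i (pderiv i q) := by
    intro i
    have : pderiv i (2 : MvPolynomial (Fin n) ℝ) = 0 := Derivation.map_natCast _ 2
    rw [pderiv_mul, h2, map_add, pderiv_mul, pderiv_mul, pderiv_mul, h2, this, pderiv_X_eq_ite,
      if_pos rfl]
    ring
  simp only [polyLaplacian_apply, h3, Finset.sum_add_distrib, ← Finset.mul_sum, h1,
    Finset.sum_const, Finset.card_univ, Fintype.card_fin, nsmul_eq_mul]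
  ring

theorem isHomogeneous_normSqPoly : (normSqPoly n).IsHomogeneous 2 :=
  IsHomogeneous.sum _ _ _ fun i _ => (isHomogeneous_X ℝ i).pow 2

theorem polyLaplacian_normSqPoly_pow_mul (hn : 0 < n) {l : ℕ} {h : MvPolynomial (Fin n) ℝ}
    (hl : h.IsHomogeneous l) (h0 : polyLaplacian n h = 0) (j : ℕ) :
    ∃ c : ℝ, 0 < c ∧ polyLaplacian n (normSqPoly n ^ (j + 1) * h) = C c * (normSqPoly n ^ j * h) := by
  have e2 : (C 2 : MvPolynomial (Fin n) ℝ) = 2 := map_ofNat C 2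
  have e4 : (C 4 : MvPolynomial (Fin n) ℝ) = 4 := map_ofNat C 4
  induction j with
  | zero =>
    refine ⟨4 * l + 2 * n, by positivity, ?_⟩
    rw [zero_add, pow_one, polyLaplacian_normSqPoly_mul hl, h0]
    simp [e2, e4]
  | succ j ih =>
    obtain ⟨c, hc, h1⟩ := ih
    have h2 : (normSqPoly n ^ (j + 1) * h).IsHomogeneous (2 * (j + 1) + l) :=
      (isHomogeneous_normSqPoly.pow (j + 1)).mul hl
    refine ⟨c + (4 * ((2 * (j + 1) + l : ℕ) : ℝ) + 2 * n), by positivity, ?_⟩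
    rw [pow_succ' _ (j + 1), mul_assoc, polyLaplacian_normSqPoly_mul h2, h1]
    simp [e2, e4]
    ring

theorem polyLaplacian_eq_zero_of_lt {k : ℕ} (hk : k < 2) {p : MvPolynomial (Fin n) ℝ}
    (hp : p.IsHomogeneous k) : polyLaplacian n p = 0 := by
  rw [polyLaplacian_apply]
  refine Finset.sum_eq_zero fun i _ => ?_
  have h := hp.pderiv (i := i)
  rw [show k - 1 = 0 by omega] at h
  rw [totalDegree_eq_zero_iff_eq_C.1 ((totalDegree_zero_iff_isHomogeneous _).2 h)]
  simp

/-- The span of the products of powers of `|X|²` with harmonic homogeneous polynomials, of total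
degree `k`. -/
def harmonicSpan (n k : ℕ) : Submodule ℝ (MvPolynomial (Fin n) ℝ) :=
  Submodule.span ℝ {q | ∃ j l h, l + 2 * j = k ∧ h.IsHomogeneous l ∧ polyLaplacian n h = 0 ∧
    q = normSqPoly n ^ j * h}

theorem isHomogeneous_of_mem_harmonicSpan {k : ℕ} {q : MvPolynomial (Fin n) ℝ}
    (hq : q ∈ harmonicSpan n k) : q.IsHomogeneous k := by
  rw [← mem_homogeneousSubmodule]
  refine Submodule.span_le.2 ?_ hq
  rintro _ ⟨j, l, h, rfl, hl, -, rfl⟩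
  have := (isHomogeneous_normSqPoly.pow j).mul hl
  rwa [add_comm] at this

/-- A preimage of a generator is the same generator with one more factor |X|², divided by the
positive constant of `polyLaplacian_normSqPoly_pow_mul`. -/
theorem exists_polyLaplacian_eq (hn : 0 < n) {k : ℕ} {q : MvPolynomial (Fin n) ℝ}
    (hq : q ∈ harmonicSpan n k) : ∃ w ∈ harmonicSpan n (k + 2), polyLaplacian n w = q := by
  induction hq using Submodule.span_induction with
  | mem q hq =>
    obtain ⟨j, l, h, rfl, hl, h0, rfl⟩ := hq
    obtain ⟨c, hc, h1⟩ := polyLaplacian_normSqPoly_pow_mul hn hl h0 j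
    refine ⟨c⁻¹ • (normSqPoly n ^ (j + 1) * h), Submodule.smul_mem _ _
      (Submodule.subset_span ⟨j + 1, l, h, by ring, hl, h0, rfl⟩), ?_⟩
    rw [map_smul, h1, ← smul_eq_C_mul, smul_smul, inv_mul_cancel₀ hc.ne', one_smul]
  | zero => exact ⟨0, Submodule.zero_mem _, map_zero _⟩
  | add a b _ _ ha hb =>
    obtain ⟨v, hv, rfl⟩ := ha
    obtain ⟨w, hw, rfl⟩ := hb
    exact ⟨v + w, Submodule.add_mem _ hv hw, map_add _ _ _⟩
  | smul c a _ ha =>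
    obtain ⟨v, hv, rfl⟩ := ha
    exact ⟨c • v, Submodule.smul_mem _ _ hv, map_smul _ _ _⟩

/-- By induction Δp lies in the span in degree k - 2, so Δp = Δw for some w in the span in degree k,
and p - w is harmonic. -/
theorem mem_harmonicSpan (hn : 0 < n) (k : ℕ) {p : MvPolynomial (Fin n) ℝ}
    (hp : p.IsHomogeneous k) : p ∈ harmonicSpan n k := by
  induction k using Nat.strong_induction_on generalizing p with
  | _ k ih =>
  have hharm : ∀ q : MvPolynomial (Fin n) ℝ, q.IsHomogeneous k → polyLaplacian n q = 0 →
      q ∈ harmonicSpan n k := fun q hq h =>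
    Submodule.subset_span ⟨0, k, q, by simp, hq, h, by simp⟩
  rcases lt_or_ge k 2 with hk | hk
  · exact hharm p hp (polyLaplacian_eq_zero_of_lt hk hp)
  · obtain ⟨k, rfl⟩ := Nat.exists_eq_add_of_le' hk
    have hΔ : (polyLaplacian n p).IsHomogeneous k := by
      rw [polyLaplacian_apply]
      exact IsHomogeneous.sum _ _ _ fun i _ => hp.pderiv.pderiv
    obtain ⟨w, hw, h1⟩ := exists_polyLaplacian_eq hn (ih k (by omega) hΔ)
    have h2 := hharm (p - w) (hp.sub (isHomogeneous_of_mem_harmonicSpan hw)) (by simp [h1])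
    simpa using Submodule.add_mem _ h2 hw

theorem polyFun_normSqPoly (x : Sph n) : polyFun (normSqPoly n) x = 1 := by
  have h : ‖(x : EuclideanSpace ℝ (Fin n))‖ = 1 := by simp
  rw [EuclideanSpace.norm_eq, Real.sqrt_eq_one] at h
  simpa [polyFun, normSqPoly] using h

/-- Every polynomial agrees on the sphere with a sum of spherical harmonics. -/
theorem restrictToSphere_mem_iSup (hn : 0 < n) (p : MvPolynomial (Fin n) ℝ) :
    restrictToSphere n p ∈ ⨆ k, SH n k := by
  rw [← sum_homogeneousComponent p, map_sum]
  refine Submodule.sum_mem _ fun k _ => ?_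
  have h := mem_harmonicSpan hn k (homogeneousComponent_isHomogeneous k p)
  suffices harmonicSpan n k ≤ (⨆ k, SH n k).comap (restrictToSphere n) from this h
  refine Submodule.span_le.2 ?_
  rintro _ ⟨j, l, h, -, hl, h0, rfl⟩
  -- The factor |X|^(2j) is 1 on the sphere, so only the harmonic factor of degree l remains.
  refine Submodule.mem_iSup_of_mem l ⟨h, ⟨hl, h0⟩, ?_⟩
  ext x
  have := polyFun_normSqPoly x
  simp only [polyFun] at this
  simp [restrictToSphere_apply, polyFun, this]

/-- A continuous function orthogonal to all spherical harmonics vanishes. -/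
theorem eq_zero_of_forall_integral_eq_zero (hn : 0 < n) {v : Sph n → ℝ} (hv : Continuous v)
    (h : ∀ k, ∀ f ∈ SH n k, ∫ x, v x * f x ∂(surf n) = 0) : v = 0 := by
  have hpoly : ∀ p : MvPolynomial (Fin n) ℝ,
      ∫ x, v x * restrictToSphere n p x ∂(surf n) = 0 := by
    intro p
    have key : ∀ f ∈ ⨆ k, SH n k, Continuous f ∧ ∫ x, v x * f x ∂(surf n) = 0 := by
      intro f hf
      induction hf using Submodule.iSup_induction' with
      | mem k f hf => exact ⟨continuous_of_mem_SH hf, h k f hf⟩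
      | zero => exact ⟨continuous_zero, by simp⟩
      | add f g _ _ hf hg =>
        refine ⟨hf.1.add hg.1, ?_⟩
        simp only [Pi.add_apply, mul_add]
        rw [integral_add (integrable_mul_of_continuous hv hf.1)
          (integrable_mul_of_continuous hv hg.1), hf.2, hg.2, add_zero]
    exact (key _ (restrictToSphere_mem_iSup hn p)).2
  let φ : MvPolynomial (Fin n) ℝ →ₐ[ℝ] C(Sph n, ℝ) :=
    aeval fun i => ⟨fun x => (x : EuclideanSpace ℝ (Fin n)) i, by fun_prop⟩
  have hφ : ∀ p x, φ p x = restrictToSphere n p x := by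
    intro p x
    rw [restrictToSphere_apply, polyFun]
    induction p using MvPolynomial.induction_on with
    | C a => simp [φ]
    | add p q hp hq => simp [hp, hq]
    | mul_X p i hp => rw [map_mul, ContinuousMap.mul_apply, hp]; simp [φ]
  have hsep : φ.range.SeparatesPoints := by
    intro x y hxy
    have : ∃ i, (x : EuclideanSpace ℝ (Fin n)) i ≠ (y : EuclideanSpace ℝ (Fin n)) i := by
      by_contra! hc
      exact hxy (Subtype.ext (PiLp.ext hc))
    obtain ⟨i, hi⟩ := this
    exact ⟨φ (X i), ⟨φ (X i), ⟨X i, rfl⟩, rfl⟩, by simpa [hφ, restrictToSphere_apply, polyFun]⟩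
  have hsq : ∫ x, v x * v x ∂(surf n) = 0 := by
    by_contra hne
    have hpos : 0 < ∫ x, v x * v x ∂(surf n) :=
      lt_of_le_of_ne (integral_nonneg fun x => mul_self_nonneg _) (Ne.symm hne)
    set I := ∫ x, |v x| ∂(surf n) with hI
    have hI0 : 0 ≤ I := integral_nonneg fun x => abs_nonneg _
    -- If q is a polynomial within ε of v, then ∫ v² = ∫ v(v - q) ≤ ε I. This ε makes the right side
    -- smaller than ∫ v², a contradiction.
    set ε := (∫ x, v x * v x ∂(surf n)) / (I + 1)
    have hε : 0 < ε := by positivity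
    obtain ⟨⟨g, p, rfl⟩, hg⟩ :=
      ContinuousMap.exists_mem_subalgebra_near_continuousMap_of_separatesPoints φ.range hsep
        ⟨v, hv⟩ ε hε
    have hint : Integrable (fun x => v x * restrictToSphere n p x) (surf n) :=
      integrable_of_continuous (hv.mul ((contDiff_polyFun p).continuous.comp
        continuous_subtype_val))
    have h1 : ∫ x, v x * v x ∂(surf n) ≤ ε * I := by
      calc ∫ x, v x * v x ∂(surf n)
          = ∫ x, (v x * v x - v x * restrictToSphere n p x) ∂(surf n) := by
            rw [integral_sub (integrable_mul_of_continuous hv hv) hint, hpoly, sub_zero]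
        _ ≤ ∫ x, ε * |v x| ∂(surf n) := by
            refine integral_mono ((integrable_mul_of_continuous hv hv).sub hint)
              ((integrable_of_continuous hv.abs).const_mul _) fun x => ?_
            have h2 := (ContinuousMap.norm_coe_le_norm _ x).trans hg.le
            change |φ p x - v x| ≤ ε at h2
            rw [hφ] at h2
            have h3 := mul_le_mul_of_nonneg_right h2 (abs_nonneg (v x))
            rw [← abs_mul] at h3
            have h4 := neg_abs_le ((restrictToSphere n p x - v x) * v x)
            change v x * v x - v x * restrictToSphere n p x ≤ ε * |v x|
            linarith
        _ = ε * I := integral_const_mul _ _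
    have h2 : ε * (I + 1) = ∫ x, v x * v x ∂(surf n) := div_mul_cancel₀ _ (by positivity)
    linarith
  have h1 := (integral_eq_zero_iff_of_nonneg (μ := surf n) (fun x => mul_self_nonneg (v x))
    (integrable_mul_of_continuous hv hv)).1 hsq
  have h2 := (Continuous.ae_eq_iff_eq (surf n) (hv.mul hv) continuous_zero).1 h1
  ext x
  simpa using congrFun h2 x

end Polynomial

/-! ### The spherical Laplacian of zonal functions -/

section Zonal

variable {n : ℕ}

theorem dot_le_one (x y : Sph n) : dot x y ≤ 1 := by
  have := real_inner_le_norm (x : EuclideanSpace ℝ (Fin n)) (y : EuclideanSpace ℝ (Fin n))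
  simpa [dot] using this

theorem neg_one_le_dot (x y : Sph n) : -1 ≤ dot x y := by
  have := neg_le_of_abs_le (abs_real_inner_le_norm (x : EuclideanSpace ℝ (Fin n))
    (y : EuclideanSpace ℝ (Fin n)))
  simpa [dot] using this

theorem continuous_dot (x : Sph n) : Continuous (dot x) := by
  unfold dot; fun_prop

theorem norm_sub_sq_eq (x y : Sph n) :
    ‖(x : EuclideanSpace ℝ (Fin n)) - y‖ ^ 2 = 2 - 2 * dot x y := by
  rw [norm_sub_sq_real]
  simp [dot]
  ring

/-- Lagrange's identity: the summands are the squared 2×2 minors of (x, y), each counted for both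
orders of (i, j). -/
theorem sum_inner_rotVec_sq (x y : EuclideanSpace ℝ (Fin n)) :
    ∑ i, ∑ j, (inner ℝ x (rotVec i j y)) ^ 2 =
      2 * (inner ℝ x x * inner ℝ y y - inner ℝ x y ^ 2) := by
  have h : ∀ i j : Fin n, (inner ℝ x (rotVec i j y) : ℝ) ^ 2 =
      (y i * y i) * (x j * x j) + (x i * x i) * (y j * y j) - 2 * ((x i * y i) * (x j * y j)) := by
    intro i j
    rw [real_inner_comm, inner_rotVec]
    ring
  simp only [h, Finset.sum_sub_distrib, Finset.sum_add_distrib, ← Finset.mul_sum, ← Finset.sum_mul]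
  simp only [PiLp.inner_apply, RCLike.inner_apply, conj_trivial]
  simp only [mul_comm (y _) (x _)]
  ring

/-- For i ≠ j the square of the field is minus the projection to the (i, j)-plane; each coordinate
lies in n - 1 such planes, each counted twice. -/
theorem sum_inner_rotVec_rotVec (x y : EuclideanSpace ℝ (Fin n)) :
    ∑ i, ∑ j, inner ℝ x (rotVec i j (rotVec i j y)) = -(2 * ((n : ℝ) - 1) * inner ℝ x y) := by
  have h : ∀ i j : Fin n, (inner ℝ x (rotVec i j (rotVec i j y)) : ℝ) =
      (if i = j then 2 * (x j * y j) else 0) - x j * y j - x i * y i := by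
    intro i j
    rw [real_inner_comm, inner_rotVec, rotVec_apply, rotVec_apply]
    rcases eq_or_ne i j with rfl | hij
    · simp; ring
    · simp [hij, hij.symm]; ring
  simp only [h, Finset.sum_sub_distrib, Finset.sum_ite_eq, Finset.mem_univ, if_true,
    Finset.sum_const, Finset.card_univ, Fintype.card_fin, nsmul_eq_mul, ← Finset.mul_sum]
  simp only [PiLp.inner_apply, RCLike.inner_apply, conj_trivial]
  simp only [mul_comm (y _) (x _)]
  ring

theorem sub_two_mul_inner_pos {c : ℝ} (hc : 2 < c) (x y : Sph n) :
    0 < c - 2 * inner ℝ (x : EuclideanSpace ℝ (Fin n)) (y : EuclideanSpace ℝ (Fin n)) := by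
  have := dot_le_one x y
  unfold dot at this
  linarith

theorem smoothNear_rpow_inner {c : ℝ} (hc : 2 < c) (b : ℝ) (x : Sph n) :
    SmoothNear (fun z => (c - 2 * inner ℝ (x : EuclideanSpace ℝ (Fin n)) z) ^ b) := by
  intro y hy
  refine ContDiffAt.rpow_const_of_ne ?_ (sub_two_mul_inner_pos hc x ⟨y, hy⟩).ne'
  exact (contDiff_const.sub (contDiff_const.mul (contDiff_const.inner ℝ contDiff_id))).contDiffAt

theorem rotDeriv_rpow_inner {c : ℝ} (b : ℝ) (x z : EuclideanSpace ℝ (Fin n))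
    (hz : 0 < c - 2 * inner ℝ x z) (i j : Fin n) :
    rotDeriv i j (fun z => (c - 2 * inner ℝ x z) ^ b) z =
      -(2 * b) * (c - 2 * inner ℝ x z) ^ (b - 1) * inner ℝ x (rotVec i j z) := by
  have h1 : HasFDerivAt (fun z => c - 2 * inner ℝ x z) (-((2 : ℝ) • innerSL ℝ x)) z :=
    ((innerSL ℝ x).hasFDerivAt.const_mul 2).const_sub c
  rw [rotDeriv, (h1.rpow_const (Or.inl hz.ne')).fderiv]
  simp
  ring

/-- Chain rule: on φ(τ) the Laplacian is (1 - τ²) φ'' - (n-1) τ φ', the two coefficients being half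
the sums computed above; here φ(τ) = (c - 2τ)^b. The condition c > 2 keeps the base positive on the
sphere. -/
theorem sphLap_rpow_inner {c : ℝ} (hc : 2 < c) (b : ℝ) (x y : Sph n) :
    sphLap (fun z => (c - 2 * inner ℝ (x : EuclideanSpace ℝ (Fin n)) z) ^ b) y =
      4 * b * (b - 1) * (c - 2 * dot x y) ^ (b - 2) * (1 - dot x y ^ 2) +
        2 * b * ((n : ℝ) - 1) * (c - 2 * dot x y) ^ (b - 1) * dot x y := by
  have hpos := sub_two_mul_inner_pos hc x y
  have hlin : ∀ i j : Fin n, SmoothNear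
      (fun z => -(2 * b) * inner ℝ (x : EuclideanSpace ℝ (Fin n)) (rotVec i j z)) :=
    fun i j _ _ => (contDiff_const.mul (contDiff_const.inner ℝ (rotVec i j).contDiff)).contDiffAt
  have hlin' : ∀ i j : Fin n, rotDeriv i j
      (fun z => -(2 * b) * inner ℝ (x : EuclideanSpace ℝ (Fin n)) (rotVec i j z)) y =
      -(2 * b) * inner ℝ (x : EuclideanSpace ℝ (Fin n)) (rotVec i j (rotVec i j y)) := by
    intro i j
    have h : HasFDerivAt
        (fun z => -(2 * b) * inner ℝ (x : EuclideanSpace ℝ (Fin n)) (rotVec i j z))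
        ((-(2 * b)) • ((innerSL ℝ (x : EuclideanSpace ℝ (Fin n))) ∘L rotVec i j)) y :=
      ((innerSL ℝ (x : EuclideanSpace ℝ (Fin n))) ∘L rotVec i j).hasFDerivAt.const_mul _
    rw [rotDeriv, h.fderiv]
    simp
  -- The first derivative is differentiated again in the ambient space, so its formula is needed on
  -- a neighbourhood of y.
  have hev : ∀ i j : Fin n,
      rotDeriv i j (fun z => (c - 2 * inner ℝ (x : EuclideanSpace ℝ (Fin n)) z) ^ b) =ᶠ[
        nhds (y : EuclideanSpace ℝ (Fin n))]
      fun z => (c - 2 * inner ℝ (x : EuclideanSpace ℝ (Fin n)) z) ^ (b - 1) *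
        (-(2 * b) * inner ℝ (x : EuclideanSpace ℝ (Fin n)) (rotVec i j z)) := by
    intro i j
    have hcont : Continuous fun z => c - 2 * inner ℝ (x : EuclideanSpace ℝ (Fin n)) z := by
      fun_prop
    filter_upwards [hcont.continuousAt.eventually (lt_mem_nhds hpos)] with z hz
    rw [rotDeriv_rpow_inner b _ z hz]
    ring
  have key : ∀ i j : Fin n, rotDeriv i j (rotDeriv i j
      (fun z => (c - 2 * inner ℝ (x : EuclideanSpace ℝ (Fin n)) z) ^ b)) y =
      4 * b * (b - 1) * (c - 2 * dot x y) ^ (b - 2) *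
        (inner ℝ (x : EuclideanSpace ℝ (Fin n)) (rotVec i j y)) ^ 2 +
      (-(2 * b) * (c - 2 * dot x y) ^ (b - 1)) *
        inner ℝ (x : EuclideanSpace ℝ (Fin n)) (rotVec i j (rotVec i j y)) := by
    intro i j
    have h1 : rotDeriv i j (rotDeriv i j
        (fun z => (c - 2 * inner ℝ (x : EuclideanSpace ℝ (Fin n)) z) ^ b)) y =
        rotDeriv i j (fun z => (c - 2 * inner ℝ (x : EuclideanSpace ℝ (Fin n)) z) ^ (b - 1) *
        (-(2 * b) * inner ℝ (x : EuclideanSpace ℝ (Fin n)) (rotVec i j z))) y := by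
      rw [rotDeriv, (hev i j).fderiv_eq, ← rotDeriv]
    rw [h1, rotDeriv_mul i j (smoothNear_rpow_inner hc (b - 1) x) (hlin i j), hlin',
      rotDeriv_rpow_inner _ _ _ hpos, show b - 1 - 1 = b - 2 by ring, ← dot]
    ring
  simp only [sphLap, key, Finset.sum_add_distrib, ← Finset.mul_sum]
  have hx : inner ℝ (x : EuclideanSpace ℝ (Fin n)) x = (1 : ℝ) := by simp
  have hy : inner ℝ (y : EuclideanSpace ℝ (Fin n)) y = (1 : ℝ) := by simp
  rw [sum_inner_rotVec_sq, sum_inner_rotVec_rotVec, hx, hy, ← dot]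
  ring

end Zonal

/-! ### Bounded solutions of G'' = κ² G -/

section Ode

/-- Bounded solutions of `G'' = κ² G` on the half-line decay exponentially. -/
theorem exists_eq_mul_exp_of_bounded {G G' : ℝ → ℝ} {κ M : ℝ} (hκ : 0 < κ)
    (h1 : ∀ t, 0 < t → HasDerivAt G (G' t) t)
    (h2 : ∀ t, 0 < t → HasDerivAt G' (κ ^ 2 * G t) t) (hb : ∀ t, 1 ≤ t → |G t| ≤ M) :
    ∃ β, ∀ t, 0 < t → G t = β * Real.exp (-κ * t) ∧ G' t = -κ * (β * Real.exp (-κ * t)) := by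
  -- The equation factors as (d/dt - σ)(d/dt + σ) G = 0 for σ = ±κ; e^{-σt} is the integrating
  -- factor of the outer operator.
  have hconst : ∀ σ : ℝ, σ ^ 2 = κ ^ 2 → ∃ c, ∀ t, 0 < t →
      (G' t + σ * G t) * Real.exp (-σ * t) = c := by
    intro σ hσ
    have hd : ∀ t, 0 < t →
        HasDerivAt (fun t => (G' t + σ * G t) * Real.exp (-σ * t)) 0 t := by
      intro t ht
      have he : HasDerivAt (fun t => Real.exp (-σ * t)) (Real.exp (-σ * t) * (-σ)) t := by
        simpa using ((hasDerivAt_id t).const_mul (-σ)).exp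
      refine (((h2 t ht).add ((h1 t ht).const_mul σ)).mul he).congr_deriv ?_
      rw [← hσ]
      simp
      ring
    refine ⟨(G' 1 + σ * G 1) * Real.exp (-σ * 1), fun t ht => ?_⟩
    exact (convex_Ioi (0 : ℝ)).is_const_of_fderivWithin_eq_zero (𝕜 := ℝ)
      (f := fun t => (G' t + σ * G t) * Real.exp (-σ * t))
      (fun t ht => (hd t ht).differentiableAt.differentiableWithinAt)
      (fun t ht => by
        rw [fderivWithin_eq_fderiv (isOpen_Ioi.uniqueDiffWithinAt ht) (hd t ht).differentiableAt]
        ext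
        simpa using (hd t ht).deriv) ht (Set.mem_Ioi.2 one_pos)
  obtain ⟨a, ha⟩ := hconst κ rfl
  obtain ⟨b, hb'⟩ := hconst (-κ) (by ring)
  have hee : ∀ t, Real.exp (κ * t) * Real.exp (-κ * t) = 1 := fun t => by
    rw [← Real.exp_add]; simp
  have hA : ∀ t, 0 < t → G' t + κ * G t = a * Real.exp (κ * t) := fun t ht => by
    rw [← ha t ht]; linear_combination -(G' t + κ * G t) * hee t
  have hB : ∀ t, 0 < t → G' t - κ * G t = b * Real.exp (-κ * t) := fun t ht => by
    have := hb' t ht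
    rw [neg_neg] at this
    rw [← this]; linear_combination -(G' t - κ * G t) * hee t
  -- The growing mode a e^{κt} = 2κG + b e^{-κt} is bounded on t ≥ 1, while e^{κt} ≥ κt.
  have ha0 : a = 0 := by
    by_contra hne
    have hpos : 0 < |a| := abs_pos.2 hne
    have hbd : ∀ t, 1 ≤ t → |a| * (κ * t) ≤ 2 * κ * M + |b| := by
      intro t ht
      have ht0 : 0 < t := by linarith
      have e1 : a * Real.exp (κ * t) = 2 * κ * G t + b * Real.exp (-κ * t) := by
        rw [← hA t ht0, ← hB t ht0]; ring
      have e2 : Real.exp (-κ * t) ≤ 1 := Real.exp_le_one_iff.2 (by nlinarith)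
      have e3 : κ * t ≤ Real.exp (κ * t) := by linarith [Real.add_one_le_exp (κ * t)]
      calc |a| * (κ * t) ≤ |a| * Real.exp (κ * t) := by gcongr
        _ = |2 * κ * G t + b * Real.exp (-κ * t)| := by
            rw [← e1, abs_mul, abs_of_pos (Real.exp_pos _)]
        _ ≤ |2 * κ * G t| + |b * Real.exp (-κ * t)| := abs_add_le _ _
        _ = 2 * κ * |G t| + |b| * Real.exp (-κ * t) := by
            rw [abs_mul, abs_mul b, abs_of_pos (Real.exp_pos _), abs_of_pos (by positivity)]
        _ ≤ 2 * κ * M + |b| * 1 := by gcongr; exact hb t ht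
        _ = _ := by ring
    have h3 := hbd (max 1 ((2 * κ * M + |b| + 1) / (|a| * κ))) (le_max_left _ _)
    have h4 : (|a| * κ) * ((2 * κ * M + |b| + 1) / (|a| * κ)) ≤
        (|a| * κ) * max 1 ((2 * κ * M + |b| + 1) / (|a| * κ)) :=
      mul_le_mul_of_nonneg_left (le_max_right _ _) (by positivity)
    rw [mul_div_cancel₀ _ (by positivity)] at h4
    linarith
  -- With a = 0 one has G' = -κG, so G' - κG = -2κG = b e^{-κt}.
  refine ⟨-b / (2 * κ), fun t ht => ?_⟩
  have e1 := hA t ht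
  have e2 := hB t ht
  rw [ha0, zero_mul] at e1
  rw [neg_mul] at e2
  constructor
  · field_simp
    linarith
  · field_simp
    linarith

end Ode

/-! ### The semigroup kernel and its differential equation -/

section Kernel

variable {n : ℕ}

/-- The number `(n - 2) / 2`. -/
abbrev halfDim (n : ℕ) : ℝ := ((n : ℝ) - 2) / 2

theorem halfDim_pos (hn : 3 ≤ n) : 0 < halfDim n := by
  have : (3 : ℝ) ≤ n := by exact_mod_cast hn
  unfold halfDim; linarith

/-- The kernel `e^{-t(n-2)/2} P_{e^{-t}}(τ)` of the semigroup generated by `L + (n-2)/2`. -/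
def heat (n : ℕ) (t τ : ℝ) : ℝ :=
  Real.exp (-t * (((n : ℝ) - 2) / 2)) * poisson n (Real.exp (-t)) τ

/-- The function `(2 cosh t - 2 τ)^{-(n-2)/2}`, whose time derivative is a multiple of the heat
kernel. -/
def newton (n : ℕ) (t τ : ℝ) : ℝ := (2 * Real.cosh t - 2 * τ) ^ (-halfDim n)

theorem two_lt_two_mul_cosh {t : ℝ} (ht : 0 < t) : 2 < 2 * Real.cosh t := by
  have := Real.one_lt_cosh.2 ht.ne'
  linarith

theorem two_mul_cosh_sub_pos {t τ : ℝ} (ht : 0 < t) (hτ : τ ≤ 1) :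
    0 < 2 * Real.cosh t - 2 * τ := by
  linarith [two_lt_two_mul_cosh ht]

theorem sphereArea_pos (hn : 3 ≤ n) : 0 < sphereArea n := by
  have : 0 < (n : ℝ) / 2 := by positivity
  have := Real.Gamma_pos_of_pos this
  unfold sphereArea
  positivity

theorem surf_univ (hn : 3 ≤ n) : (surf n).real Set.univ = sphereArea n := by
  have hn0 : (n : ℝ) ≠ 0 := by positivity
  have : Nonempty (Fin n) := ⟨⟨0, by omega⟩⟩
  have hg : 0 < Real.Gamma ((n : ℝ) / 2) := Real.Gamma_pos_of_pos (by positivity)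
  rw [Measure.toSphere_real_apply_univ, measureReal_def, EuclideanSpace.volume_ball]
  simp only [ENNReal.ofReal_one, one_pow, one_mul, Fintype.card_fin, finrank_euclideanSpace]
  rw [ENNReal.toReal_ofReal (div_nonneg (by positivity) (Real.Gamma_nonneg_of_nonneg
    (by positivity))), Real.Gamma_add_one (by positivity), sphereArea, Real.sqrt_eq_rpow,
    ← Real.rpow_natCast, ← Real.rpow_mul Real.pi_pos.le, show 1 / 2 * (n : ℝ) = n / 2 by ring]
  field_simp

/-- With r = e^{-t}: 1 - 2rτ + r² = r(2 cosh t - 2τ) and 1 - r² = 2r sinh t. The factor e^{-tm} =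
r^m is exactly what cancels the remaining powers of r. -/
theorem heat_eq {t τ : ℝ} (ht : 0 < t) (hτ : τ ≤ 1) :
    heat n t τ =
      2 * Real.sinh t / (sphereArea n * (2 * Real.cosh t - 2 * τ) ^ ((n : ℝ) / 2)) := by
  have hW := two_mul_cosh_sub_pos ht hτ
  have h1 : Real.exp (-t) * Real.exp t = 1 := by rw [← Real.exp_add]; simp
  have h2 : 1 - 2 * Real.exp (-t) * τ + Real.exp (-t) ^ 2 =
      Real.exp (-t) * (2 * Real.cosh t - 2 * τ) := by
    rw [Real.cosh_eq]; linear_combination -h1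
  have h3 : 1 - Real.exp (-t) ^ 2 = Real.exp (-t) * (2 * Real.sinh t) := by
    rw [Real.sinh_eq]; linear_combination -h1
  have h4 : Real.exp (-t * (((n : ℝ) - 2) / 2)) * Real.exp (-t) =
      Real.exp (-t) ^ ((n : ℝ) / 2) := by
    rw [← Real.exp_add, ← Real.exp_mul]; ring_nf
  rw [heat, poisson, h2, h3, Real.mul_rpow (Real.exp_pos _).le hW.le, ← h4]
  have := Real.rpow_pos_of_pos hW ((n : ℝ) / 2)
  have := Real.exp_pos (-t)
  have := Real.exp_pos (-t * (((n : ℝ) - 2) / 2))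
  rcases eq_or_ne (sphereArea n) 0 with h | h
  · simp [h]
  · field_simp

theorem heat_eq_newton {t τ : ℝ} (ht : 0 < t) (hτ : τ ≤ 1) :
    heat n t τ =
      2 * Real.sinh t / sphereArea n * (2 * Real.cosh t - 2 * τ) ^ (-halfDim n - 1) := by
  rw [heat_eq ht hτ, show -halfDim n - 1 = -((n : ℝ) / 2) by rw [halfDim]; ring,
    Real.rpow_neg (two_mul_cosh_sub_pos ht hτ).le]
  ring

theorem heat_nonneg (hn : 3 ≤ n) {t τ : ℝ} (ht : 0 < t) (hτ : τ ≤ 1) : 0 ≤ heat n t τ := by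
  have := two_mul_cosh_sub_pos ht hτ
  have := sphereArea_pos hn
  have := Real.sinh_pos_iff.2 ht
  rw [heat_eq ht hτ]
  positivity

theorem continuousOn_rpow_cosh_sub (b : ℝ) : ContinuousOn
    (fun q : ℝ × ℝ => (2 * Real.cosh q.1 - 2 * q.2) ^ b) (Set.Ioi 0 ×ˢ Set.Iic 1) := by
  refine ContinuousOn.rpow_const (by fun_prop) ?_
  rintro ⟨t, τ⟩ ⟨ht, hτ⟩
  exact Or.inl (two_mul_cosh_sub_pos ht hτ).ne'

theorem continuousOn_heat : ContinuousOn
    (fun q : ℝ × ℝ => heat n q.1 q.2) (Set.Ioi 0 ×ˢ Set.Iic 1) := by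
  have h : ContinuousOn (fun q : ℝ × ℝ => 2 * Real.sinh q.1 / sphereArea n *
      (2 * Real.cosh q.1 - 2 * q.2) ^ (-halfDim n - 1)) (Set.Ioi 0 ×ˢ Set.Iic 1) :=
    ContinuousOn.mul (by fun_prop) (continuousOn_rpow_cosh_sub _)
  exact h.congr fun q hq => heat_eq_newton hq.1 hq.2

theorem ContinuousOn.comp_dot {F : ℝ × ℝ → ℝ} (hF : ContinuousOn F (Set.Ioi 0 ×ˢ Set.Iic 1))
    (x : Sph n) :
    ContinuousOn (fun q : ℝ × Sph n => F (q.1, dot x q.2)) (Set.Ioi 0 ×ˢ Set.univ) :=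
  hF.comp (by have := continuous_dot x; fun_prop) fun q hq => ⟨hq.1, dot_le_one _ _⟩

theorem continuous_slice {F : ℝ × Sph n → ℝ} (hF : ContinuousOn F (Set.Ioi 0 ×ˢ Set.univ)) {t : ℝ}
    (ht : 0 < t) : Continuous fun y => F (t, y) := by
  rw [← continuousOn_univ]
  exact hF.comp (by fun_prop) fun y _ => ⟨ht, trivial⟩

theorem continuous_heat_dot {t : ℝ} (ht : 0 < t) (x : Sph n) :
    Continuous fun y => heat n t (dot x y) :=
  continuous_slice (ContinuousOn.comp_dot continuousOn_heat x) ht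

theorem hasDerivAt_rpow_cosh_sub {t τ : ℝ} (b : ℝ) (ht : 0 < t) (hτ : τ ≤ 1) :
    HasDerivAt (fun t => (2 * Real.cosh t - 2 * τ) ^ b)
      (2 * b * Real.sinh t * (2 * Real.cosh t - 2 * τ) ^ (b - 1)) t := by
  have h := (((Real.hasDerivAt_cosh t).const_mul 2).sub_const (2 * τ)).rpow_const (p := b)
    (Or.inl (two_mul_cosh_sub_pos ht hτ).ne')
  exact h.congr_deriv (by ring)

theorem hasDerivAt_newton (hn : 3 ≤ n) {t τ : ℝ} (ht : 0 < t) (hτ : τ ≤ 1) :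
    HasDerivAt (fun t => newton n t τ) (-(halfDim n * sphereArea n) * heat n t τ) t := by
  have := sphereArea_pos hn
  refine (hasDerivAt_rpow_cosh_sub _ ht hτ).congr_deriv ?_
  rw [heat_eq_newton ht hτ]
  field_simp

theorem smoothNear_newton {t : ℝ} (ht : 0 < t) (x : Sph n) :
    SmoothNear (fun z => newton n t (inner ℝ (x : EuclideanSpace ℝ (Fin n)) z)) :=
  smoothNear_rpow_inner (two_lt_two_mul_cosh ht) _ x

/-- The function differentiated is ∂_t newton, so this is ∂_t² newton = m² newton - Δ newton, the
harmonicity of |rx - y|^{2-n} = r^{-m} newton. All terms are multiples of (2 cosh t - 2τ)^{-m-2},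
and the identity reduces to cosh² = 1 + sinh². -/
theorem hasDerivAt_heat (hn : 3 ≤ n) {t : ℝ} (ht : 0 < t) (x y : Sph n) :
    HasDerivAt (fun t => -(halfDim n * sphereArea n) * heat n t (dot x y))
      (halfDim n ^ 2 * newton n t (dot x y) -
        sphLap (fun z => newton n t (inner ℝ (x : EuclideanSpace ℝ (Fin n)) z)) y) t := by
  have hω := sphereArea_pos hn
  have hτ := dot_le_one x y
  have h1 : (fun t => -(halfDim n * sphereArea n) * heat n t (dot x y)) =ᶠ[nhds t]
      fun t => -2 * halfDim n * (Real.sinh t *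
        (2 * Real.cosh t - 2 * dot x y) ^ (-halfDim n - 1)) := by
    filter_upwards [lt_mem_nhds ht] with s hs
    rw [heat_eq_newton hs hτ]
    field_simp
  refine HasDerivAt.congr_of_eventuallyEq ?_ h1
  refine (((Real.hasDerivAt_sinh t).mul
    (hasDerivAt_rpow_cosh_sub (-halfDim n - 1) ht hτ)).const_mul _).congr_deriv ?_
  have hW := two_mul_cosh_sub_pos ht hτ
  have e := sphLap_rpow_inner (two_lt_two_mul_cosh ht) (-halfDim n) x y
  simp only [newton]
  rw [e]
  have e1 : (2 * Real.cosh t - 2 * dot x y) ^ (-halfDim n - 1) =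
      (2 * Real.cosh t - 2 * dot x y) ^ (-halfDim n - 2) * (2 * Real.cosh t - 2 * dot x y) := by
    rw [← Real.rpow_add_one hW.ne']; ring_nf
  have e2 : (2 * Real.cosh t - 2 * dot x y) ^ (-halfDim n) =
      (2 * Real.cosh t - 2 * dot x y) ^ (-halfDim n - 2) *
        (2 * Real.cosh t - 2 * dot x y) ^ 2 := by
    rw [← Real.rpow_natCast, ← Real.rpow_add hW]; push_cast; ring_nf
  have e3 : (n : ℝ) - 1 = 2 * halfDim n + 1 := by rw [halfDim]; ring
  have e4 : -halfDim n - 1 - 1 = -halfDim n - 2 := by ring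
  rw [e3, e4, e1, e2]
  generalize (2 * Real.cosh t - 2 * dot x y) ^ (-halfDim n - 2) = Z
  have hcs := Real.cosh_sq t
  generalize halfDim n = m
  generalize dot x y = τ
  linear_combination (-4 * m * (m + 1) * Z) * hcs

/-- Differentiation under the integral over the sphere. -/
theorem hasDerivAt_integral_sphere {F F' : ℝ × Sph n → ℝ}
    (hF : ContinuousOn F (Set.Ioi 0 ×ˢ Set.univ)) (hF' : ContinuousOn F' (Set.Ioi 0 ×ˢ Set.univ))
    (hd : ∀ t, 0 < t → ∀ y, HasDerivAt (fun t => F (t, y)) (F' (t, y)) t) {t : ℝ} (ht : 0 < t) :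
    HasDerivAt (fun t => ∫ y, F (t, y) ∂(surf n)) (∫ y, F' (t, y) ∂(surf n)) t := by
  have hsub : Set.Icc (t / 2) (2 * t) ×ˢ (Set.univ : Set (Sph n)) ⊆ Set.Ioi 0 ×ˢ Set.univ :=
    Set.prod_mono (fun s hs => lt_of_lt_of_le (by positivity) hs.1) subset_rfl
  obtain ⟨C, hC⟩ := (isCompact_Icc.prod isCompact_univ).exists_bound_of_continuousOn (hF'.mono hsub)
  refine (hasDerivAt_integral_of_dominated_loc_of_deriv_le (μ := surf n) (𝕜 := ℝ)
    (F := fun t y => F (t, y)) (F' := fun t y => F' (t, y)) (bound := fun _ => C)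
    (s := Set.Icc (t / 2) (2 * t)) (Icc_mem_nhds (by linarith) (by linarith)) ?_
    (integrable_of_continuous (continuous_slice hF ht))
    (continuous_slice hF' ht).aestronglyMeasurable
    (.of_forall fun y s hs => hC (s, y) ⟨hs, trivial⟩) (integrable_const _)
    (.of_forall fun y s hs => hd s (lt_of_lt_of_le (by positivity) hs.1) y)).2
  filter_upwards [lt_mem_nhds ht] with s hs
  exact (continuous_slice hF hs).aestronglyMeasurable

theorem continuousOn_newton : ContinuousOn
    (fun q : ℝ × ℝ => newton n q.1 q.2) (Set.Ioi 0 ×ˢ Set.Iic 1) :=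
  continuousOn_rpow_cosh_sub _

theorem continuousOn_sphLap_newton (x : Sph n) : ContinuousOn (fun q : ℝ × Sph n =>
    sphLap (fun z => newton n q.1 (inner ℝ (x : EuclideanSpace ℝ (Fin n)) z)) q.2)
    (Set.Ioi 0 ×ˢ Set.univ) := by
  have h : ContinuousOn (fun q : ℝ × Sph n =>
      4 * (-halfDim n) * (-halfDim n - 1) *
        (2 * Real.cosh q.1 - 2 * dot x q.2) ^ (-halfDim n - 2) * (1 - dot x q.2 ^ 2) +
      2 * (-halfDim n) * ((n : ℝ) - 1) *
        (2 * Real.cosh q.1 - 2 * dot x q.2) ^ (-halfDim n - 1) * dot x q.2)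
      (Set.Ioi 0 ×ˢ Set.univ) := by
    have h1 : Continuous fun q : ℝ × Sph n => dot x q.2 := (continuous_dot x).comp continuous_snd
    have h2 := ContinuousOn.comp_dot (continuousOn_rpow_cosh_sub (-halfDim n - 2)) x
    have h3 := ContinuousOn.comp_dot (continuousOn_rpow_cosh_sub (-halfDim n - 1)) x
    exact ((continuousOn_const.mul h2).mul (continuous_const.sub (h1.pow 2)).continuousOn).add
      ((continuousOn_const.mul h3).mul h1.continuousOn)
  exact h.congr fun q hq => sphLap_rpow_inner (two_lt_two_mul_cosh hq.1) _ x q.2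

theorem newton_nonneg {t τ : ℝ} (ht : 0 < t) (hτ : τ ≤ 1) : 0 ≤ newton n t τ :=
  Real.rpow_nonneg (two_mul_cosh_sub_pos ht hτ).le _

theorem newton_le (hn : 3 ≤ n) {t τ : ℝ} (ht : 1 ≤ t) (hτ : τ ≤ 1) :
    newton n t τ ≤ newton n 1 1 := by
  have h1 : Real.cosh 1 ≤ Real.cosh t := Real.cosh_le_cosh.2 (by
    rw [abs_of_pos one_pos, abs_of_pos (by linarith)]; exact ht)
  refine Real.rpow_le_rpow_of_nonpos (two_mul_cosh_sub_pos one_pos le_rfl) (by linarith) ?_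
  linarith [halfDim_pos hn]

/-- Spherical harmonics are eigenfunctions of the semigroup, up to the identification of the
constant. -/
theorem exists_integral_newton (hn : 3 ≤ n) {k : ℕ} {p : MvPolynomial (Fin n) ℝ}
    (hp : p.IsHomogeneous k) (h0 : polyLaplacian n p = 0) (x : Sph n) :
    ∃ β, ∀ t, 0 < t →
      ∫ y : Sph n, polyFun p y * newton n t (dot x y) ∂(surf n) =
        β * Real.exp (-(k + halfDim n) * t) ∧
      ∫ y : Sph n, polyFun p y * heat n t (dot x y) ∂(surf n) =
        (k + halfDim n) / (halfDim n * sphereArea n) * (β * Real.exp (-(k + halfDim n) * t)) := by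
  have hm := halfDim_pos hn
  have hω := sphereArea_pos hn
  have hpc : Continuous fun y : Sph n => polyFun p y := (smoothNear_polyFun p).continuous
  have hpc' : ContinuousOn (fun q : ℝ × Sph n => polyFun p q.2) (Set.Ioi 0 ×ˢ Set.univ) :=
    (hpc.comp continuous_snd).continuousOn
  have cN := ContinuousOn.comp_dot (continuousOn_newton (n := n)) x
  have cH := ContinuousOn.comp_dot (continuousOn_heat (n := n)) x
  have cL := continuousOn_sphLap_newton x
  have hG := fun t ht => hasDerivAt_integral_sphere
    (F := fun q => polyFun p q.2 * newton n q.1 (dot x q.2))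
    (F' := fun q => polyFun p q.2 * (-(halfDim n * sphereArea n) * heat n q.1 (dot x q.2)))
    (hpc'.mul cN) (hpc'.mul (continuousOn_const.mul cH))
    (fun t ht y => (hasDerivAt_newton hn ht (dot_le_one x y)).const_mul (polyFun p y)) (t := t) ht
  have hG' := fun t ht => hasDerivAt_integral_sphere
    (F := fun q => polyFun p q.2 * (-(halfDim n * sphereArea n) * heat n q.1 (dot x q.2)))
    (F' := fun q => polyFun p q.2 * (halfDim n ^ 2 * newton n q.1 (dot x q.2) -
        sphLap (fun z => newton n q.1 (inner ℝ (x : EuclideanSpace ℝ (Fin n)) z)) q.2))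
    (hpc'.mul (continuousOn_const.mul cH)) (hpc'.mul ((continuousOn_const.mul cN).sub cL))
    (fun t ht y => (hasDerivAt_heat hn ht x y).const_mul (polyFun p y)) (t := t) ht
  -- Self-adjointness moves the Laplacian to p, and m² + k(k+n-2) = (k+m)² is a perfect square.
  have hint : ∀ t, 0 < t → ∫ y : Sph n, polyFun p y * (halfDim n ^ 2 * newton n t (dot x y) -
        sphLap (fun z => newton n t (inner ℝ (x : EuclideanSpace ℝ (Fin n)) z)) y) ∂(surf n) =
      (k + halfDim n) ^ 2 * ∫ y : Sph n, polyFun p y * newton n t (dot x y) ∂(surf n) := by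
    intro t ht
    have hs := smoothNear_newton ht x
    have i1 : Integrable (fun y : Sph n => polyFun p y * newton n t (dot x y)) (surf n) :=
      integrable_mul_of_continuous hpc (continuous_slice cN ht)
    have i2 := integrable_mul_of_continuous hpc hs.sphLap.continuous
    have e1 : ∫ y : Sph n, polyFun p y * sphLap
          (fun z => newton n t (inner ℝ (x : EuclideanSpace ℝ (Fin n)) z)) y ∂(surf n) =
        -((k : ℝ) * (k + n - 2)) * ∫ y : Sph n, polyFun p y * newton n t (dot x y) ∂(surf n) := by
      rw [← integral_sphLap_mul (smoothNear_polyFun p) hs, ← integral_const_mul]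
      simp only [sphLap_polyFun hp h0, mul_assoc, dot]
    have e2 : ∀ y : Sph n, polyFun p y * (halfDim n ^ 2 * newton n t (dot x y) -
        sphLap (fun z => newton n t (inner ℝ (x : EuclideanSpace ℝ (Fin n)) z)) y) =
        halfDim n ^ 2 * (polyFun p y * newton n t (dot x y)) - polyFun p y *
        sphLap (fun z => newton n t (inner ℝ (x : EuclideanSpace ℝ (Fin n)) z)) y :=
      fun y => by ring
    simp only [e2]
    rw [integral_sub (i1.const_mul _) i2, e1, integral_const_mul, halfDim]
    ring
  obtain ⟨C, hC⟩ := isCompact_univ.exists_bound_of_continuousOn hpc.continuousOn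
  obtain ⟨β, hβ⟩ := exists_eq_mul_exp_of_bounded (κ := k + halfDim n)
    (M := C * newton n 1 1 * (surf n).real Set.univ) (by positivity) hG
    (fun t ht => (hG' t ht).congr_deriv (hint t ht)) (fun t ht => by
      rw [← Real.norm_eq_abs]
      refine norm_integral_le_of_norm_le_const (μ := surf n) (.of_forall fun y => ?_)
      have hN := newton_nonneg (n := n) (lt_of_lt_of_le one_pos ht) (dot_le_one x y)
      rw [norm_mul, Real.norm_of_nonneg hN]
      exact mul_le_mul (hC y trivial) (newton_le hn ht (dot_le_one x y)) hN
        ((norm_nonneg _).trans (hC y trivial)))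
  refine ⟨β, fun t ht => ⟨(hβ t ht).1, ?_⟩⟩
  -- The derivative of the `newton` integral is -mω times the `heat` integral, so its formula
  -- determines the latter.
  have h := (hβ t ht).2
  simp only [mul_left_comm _ (-(halfDim n * sphereArea n)), integral_const_mul] at h
  rw [div_mul_eq_mul_div, eq_div_iff (by positivity)]
  linarith

end Kernel

/-! ### Total mass, concentration as t → 0, and the eigenvalues of the semigroup -/

section ApproximateIdentity

variable {n : ℕ}

/-- A function that is smooth near the sphere satisfies a Lipschitz estimate at every point. -/
theorem SmoothNear.exists_lipschitz_at {f : EuclideanSpace ℝ (Fin n) → ℝ} (hf : SmoothNear f)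
    (x : Sph n) : ∃ K, 0 ≤ K ∧ ∀ y : Sph n,
      |f x - f y| ≤ K * ‖(x : EuclideanSpace ℝ (Fin n)) - y‖ := by
  obtain ⟨K, hK⟩ := (hf.differentiableAt x).isBigO_sub.bound
  obtain ⟨ε, hε, hball⟩ := Metric.eventually_nhds_iff.1 hK
  obtain ⟨M, hM⟩ := isCompact_univ.exists_bound_of_continuousOn hf.continuous.continuousOn
  have hM0 : 0 ≤ M := (norm_nonneg _).trans (hM x trivial)
  -- Differentiability at x gives K within distance ε; farther away the oscillation 2M is at most
  -- 2M/ε times the distance.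
  refine ⟨max K (2 * M / ε), le_max_of_le_right (by positivity), fun y => ?_⟩
  rw [abs_sub_comm, norm_sub_rev]
  rcases lt_or_ge (dist (y : EuclideanSpace ℝ (Fin n)) x) ε with h | h
  · exact (hball h).trans (mul_le_mul_of_nonneg_right (le_max_left _ _) (norm_nonneg _))
  · rw [dist_eq_norm] at h
    have h1 : |f y - f x| ≤ 2 * M := by
      have := abs_sub (f y) (f x)
      have h2 : |f y| ≤ M := hM y trivial
      have h3 : |f x| ≤ M := hM x trivial
      linarith
    calc |f y - f x| ≤ 2 * M / ε * ε := by rwa [div_mul_cancel₀ _ hε.ne']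
      _ ≤ max K (2 * M / ε) * ‖(y : EuclideanSpace ℝ (Fin n)) - x‖ :=
        mul_le_mul (le_max_right _ _) h hε.le (le_max_of_le_right (by positivity))

/-- Degree 0 gives β e^{-mt}. Since e^{mt} newton = (1 - 2τ e^{-t} + e^{-2t})^{-m} tends to 1 as t →
∞, β is the total area. -/
theorem integral_newton (hn : 3 ≤ n) (x : Sph n) {t : ℝ} (ht : 0 < t) :
    ∫ y, newton n t (dot x y) ∂(surf n) = sphereArea n * Real.exp (-halfDim n * t) := by
  have hm := halfDim_pos hn
  obtain ⟨β, hβ⟩ := exists_integral_newton hn (MvPolynomial.isHomogeneous_one (Fin n) ℝ)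
    (by simp [polyLaplacian_apply]) x
  have h1 : ∀ t, 0 < t → ∫ y, newton n t (dot x y) ∂(surf n) = β * Real.exp (-halfDim n * t) := by
    intro t ht
    simpa [polyFun] using (hβ t ht).1
  -- The right side is 1 - 2rτ + r² with r = e^{-t}, smallest at τ = 1. For t ≥ 1 this provides the
  -- constant majorant for dominated convergence.
  have hpos : ∀ t, 0 < t → ∀ y : Sph n, (1 - Real.exp (-t)) ^ 2 ≤
      Real.exp (-t) * (2 * Real.cosh t - 2 * dot x y) := by
    intro t ht y
    have e1 : Real.exp (-t) * Real.exp t = 1 := by rw [← Real.exp_add]; simp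
    rw [Real.cosh_eq]
    nlinarith [dot_le_one x y, Real.exp_pos (-t)]
  have hform : ∀ t, 0 < t → ∀ y : Sph n, Real.exp (halfDim n * t) * newton n t (dot x y) =
      (Real.exp (-t) * (2 * Real.cosh t - 2 * dot x y)) ^ (-halfDim n) := by
    intro t ht y
    rw [Real.mul_rpow (Real.exp_pos _).le (two_mul_cosh_sub_pos ht (dot_le_one x y)).le,
      ← Real.exp_mul, newton]
    ring_nf
  have hexp : ∀ t : ℝ, 1 ≤ t → Real.exp (-t) ≤ Real.exp (-1) := fun t ht =>
    Real.exp_le_exp.2 (by linarith)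
  have hexp1 : Real.exp (-1 : ℝ) < 1 := by simp
  have hlim : Tendsto (fun t => ∫ y, Real.exp (halfDim n * t) * newton n t (dot x y) ∂(surf n))
      atTop (𝓝 (∫ _ : Sph n, (1 : ℝ) ∂(surf n))) := by
    refine tendsto_integral_filter_of_dominated_convergence
      (fun _ => ((1 - Real.exp (-1)) ^ 2) ^ (-halfDim n)) ?_ ?_ (integrable_const _) ?_
    · filter_upwards [eventually_gt_atTop 0] with t ht
      exact (continuous_const.mul (continuous_slice
        (ContinuousOn.comp_dot continuousOn_newton x) ht)).aestronglyMeasurable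
    · filter_upwards [eventually_ge_atTop 1] with t ht
      refine .of_forall fun y => ?_
      have ht0 : 0 < t := by linarith
      have hb := hexp t ht
      have hsq : (1 - Real.exp (-1)) ^ 2 ≤ Real.exp (-t) * (2 * Real.cosh t - 2 * dot x y) :=
        (pow_le_pow_left₀ (by linarith) (by linarith) 2).trans (hpos t ht0 y)
      have hp : 0 < (1 - Real.exp (-1 : ℝ)) ^ 2 := pow_pos (by linarith) 2
      rw [hform t ht0 y, Real.norm_of_nonneg (Real.rpow_nonneg (hp.le.trans hsq) _)]
      exact Real.rpow_le_rpow_of_nonpos hp hsq (by linarith)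
    · refine .of_forall fun y => ?_
      have e : Tendsto (fun t : ℝ => Real.exp (-t)) atTop (𝓝 0) := Real.tendsto_exp_neg_atTop_nhds_zero
      have h2 : Tendsto (fun t : ℝ => (1 - 2 * dot x y * Real.exp (-t) + Real.exp (-t) ^ 2) ^
          (-halfDim n)) atTop (𝓝 1) := by
        have h3 : Tendsto (fun t : ℝ => 1 - 2 * dot x y * Real.exp (-t) + Real.exp (-t) ^ 2)
            atTop (𝓝 1) := by
          have := (tendsto_const_nhds (x := (1 : ℝ))).sub (e.const_mul (2 * dot x y)) |>.add (e.pow 2)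
          simpa using this
        have := h3.rpow_const (p := -halfDim n) (Or.inl one_ne_zero)
        simpa using this
      refine h2.congr' ?_
      filter_upwards [eventually_gt_atTop 0] with t ht
      rw [hform t ht y]
      congr 1
      have e1 : Real.exp (-t) * Real.exp t = 1 := by rw [← Real.exp_add]; simp
      rw [Real.cosh_eq]
      linear_combination -e1
  have hβ' : β = sphereArea n := by
    refine tendsto_nhds_unique (tendsto_const_nhds.congr' ?_) (by
      simpa [surf_univ hn, ← measureReal_def] using hlim)
    filter_upwards [eventually_gt_atTop 0] with t ht
    rw [integral_const_mul, h1 t ht, mul_left_comm, ← Real.exp_add]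
    simp
  rw [h1 t ht, hβ']

theorem integral_heat (hn : 3 ≤ n) (x : Sph n) {t : ℝ} (ht : 0 < t) :
    ∫ y, heat n t (dot x y) ∂(surf n) = Real.exp (-halfDim n * t) := by
  have hm := halfDim_pos hn
  have hω := sphereArea_pos hn
  obtain ⟨β, hβ⟩ := exists_integral_newton hn (MvPolynomial.isHomogeneous_one (Fin n) ℝ)
    (by simp [polyLaplacian_apply]) x
  have h1 := hβ t ht
  rw [← h1.1] at h1
  have h2 := h1.2
  simp only [polyFun, map_one, one_mul, integral_newton hn x ht] at h2
  rw [h2]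
  generalize halfDim n = m at *
  simp only [Nat.cast_zero, zero_add]
  field_simp

theorem sinh_le_mul_cosh {t : ℝ} (ht : 0 ≤ t) : Real.sinh t ≤ t * Real.cosh t := by
  have h := Convex.norm_image_sub_le_of_norm_hasDerivWithin_le (f := Real.sinh) (f' := Real.cosh)
    (C := Real.cosh t) (s := Set.Icc 0 t) (x := 0) (y := t)
    (fun x _ => (Real.hasDerivAt_sinh x).hasDerivWithinAt) (fun x hx => by
      rw [Real.norm_of_nonneg (Real.cosh_pos x).le]
      exact Real.cosh_le_cosh.2 (by rw [abs_of_nonneg hx.1, abs_of_nonneg ht]; exact hx.2))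
    (convex_Icc _ _) ⟨le_rfl, ht⟩ ⟨ht, le_rfl⟩
  rw [Real.sinh_zero, sub_zero, sub_zero, Real.norm_of_nonneg (Real.sinh_nonneg_iff.2 ht),
    Real.norm_of_nonneg ht] at h
  linarith

/-- Since |x - y|² = 2 - 2τ ≤ 2 cosh t - 2τ, multiplying by it raises the exponent of `heat` by one,
to that of `newton`. Thus the second moment of `heat` is O(t) as t → 0. -/
theorem norm_sq_mul_heat_le (hn : 3 ≤ n) (x y : Sph n) {t : ℝ} (ht : 0 < t) :
    ‖(x : EuclideanSpace ℝ (Fin n)) - y‖ ^ 2 * heat n t (dot x y) ≤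
      2 * Real.sinh t / sphereArea n * newton n t (dot x y) := by
  have hτ := dot_le_one x y
  have hW := two_mul_cosh_sub_pos ht hτ
  have hω := sphereArea_pos hn
  have hs := Real.sinh_pos_iff.2 ht
  have h1 : ‖(x : EuclideanSpace ℝ (Fin n)) - y‖ ^ 2 ≤ 2 * Real.cosh t - 2 * dot x y := by
    rw [norm_sub_sq_eq]; linarith [two_lt_two_mul_cosh ht]
  refine (mul_le_mul_of_nonneg_right h1 (heat_nonneg hn ht hτ)).trans_eq ?_
  rw [heat_eq_newton ht hτ, newton, mul_left_comm, ← Real.rpow_one_add' hW.le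
    (by linarith [halfDim_pos hn])]
  ring_nf

/-- The bound d ≤ √t + d²/√t for d = |x - y| replaces the first moment by the mass and the second
moment, which is O(t); the weight √t balances the two. -/
theorem abs_integral_sub_mul_heat_le (hn : 3 ≤ n) {f : Sph n → ℝ} (hf : Continuous f) (x : Sph n)
    {K : ℝ} (hK : 0 ≤ K)
    (hfx : ∀ y, |f x - f y| ≤ K * ‖(x : EuclideanSpace ℝ (Fin n)) - y‖) {t : ℝ} (ht : 0 < t)
    (ht1 : t ≤ 1) :
    |∫ y, (f x - f y) * heat n t (dot x y) ∂(surf n)| ≤ K * (1 + 2 * Real.cosh 1) * √t := by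
  have hω := sphereArea_pos hn
  have hm := halfDim_pos hn
  have hs0 : 0 < √t := Real.sqrt_pos.2 ht
  have hss : √t * √t = t := Real.mul_self_sqrt ht.le
  have cH := continuous_heat_dot (n := n) ht x
  have cN : Continuous fun y => newton n t (dot x y) := continuous_slice
    (ContinuousOn.comp_dot continuousOn_newton x) ht
  have hsinh : 0 < Real.sinh t := Real.sinh_pos_iff.2 ht
  calc |∫ y, (f x - f y) * heat n t (dot x y) ∂(surf n)|
      ≤ ∫ y, |(f x - f y) * heat n t (dot x y)| ∂(surf n) := abs_integral_le_integral_abs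
    _ ≤ ∫ y, (K * √t * heat n t (dot x y) +
          K / √t * (2 * Real.sinh t / sphereArea n * newton n t (dot x y))) ∂(surf n) := by
        refine integral_mono (integrable_of_continuous (by fun_prop))
          (integrable_of_continuous (by fun_prop)) fun y => ?_
        have hh := heat_nonneg hn ht (dot_le_one x y)
        have h1 := norm_sq_mul_heat_le hn x y ht
        set d := ‖(x : EuclideanSpace ℝ (Fin n)) - y‖
        have hd : d ≤ √t + d ^ 2 / √t := by
          rw [← sub_le_iff_le_add', le_div_iff₀ hs0]
          nlinarith [sq_nonneg (d - √t)]
        change |(f x - f y) * heat n t (dot x y)| ≤ _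
        rw [abs_mul, abs_of_nonneg hh]
        calc |f x - f y| * heat n t (dot x y) ≤ K * d * heat n t (dot x y) := by
              gcongr; exact hfx y
          _ ≤ K * (√t + d ^ 2 / √t) * heat n t (dot x y) := by gcongr
          _ = K * √t * heat n t (dot x y) + K / √t * (d ^ 2 * heat n t (dot x y)) := by ring
          _ ≤ _ := by gcongr
    _ = (K * √t + K / √t * (2 * Real.sinh t)) * Real.exp (-halfDim n * t) := by
        rw [integral_add (integrable_of_continuous (by fun_prop))
          (integrable_of_continuous (by fun_prop)), integral_const_mul, integral_const_mul,
          integral_const_mul, integral_heat hn x ht, integral_newton hn x ht]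
        field_simp
    _ ≤ (K * √t + K / √t * (2 * (t * Real.cosh 1))) * 1 := by
        gcongr
        · refine (sinh_le_mul_cosh ht.le).trans (mul_le_mul_of_nonneg_left ?_ ht.le)
          exact Real.cosh_le_cosh.2 (by rw [abs_of_pos ht, abs_one]; exact ht1)
        · exact Real.exp_le_one_iff.2 (by nlinarith)
    _ = K * (1 + 2 * Real.cosh 1) * √t := by
        field_simp
        rw [Real.sq_sqrt ht.le]
        ring

/-- The integral is A e^{-(k+m)t} for some A independent of t, and it differs from p(x) e^{-mt} by
O(√t); letting t → 0 gives A = p(x). -/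
theorem integral_polyFun_mul_heat (hn : 3 ≤ n) {k : ℕ} {p : MvPolynomial (Fin n) ℝ}
    (hp : p.IsHomogeneous k) (h0 : polyLaplacian n p = 0) (x : Sph n) {t : ℝ} (ht : 0 < t) :
    ∫ y : Sph n, polyFun p y * heat n t (dot x y) ∂(surf n) =
      Real.exp (-(k + halfDim n) * t) * polyFun p x := by
  obtain ⟨β, hβ⟩ := exists_integral_newton hn hp h0 x
  obtain ⟨K, hK, hfx⟩ := (smoothNear_polyFun p).exists_lipschitz_at x
  have hc := (smoothNear_polyFun p).continuous
  set A := (k + halfDim n) / (halfDim n * sphereArea n) * β with hA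
  have h1 : ∀ t, 0 < t → ∫ y : Sph n, polyFun p y * heat n t (dot x y) ∂(surf n) =
      A * Real.exp (-(k + halfDim n) * t) := fun t ht => by rw [(hβ t ht).2, hA]; ring
  have hlim : Tendsto (fun t => polyFun p x * Real.exp (-halfDim n * t) -
      A * Real.exp (-(k + halfDim n) * t)) (𝓝[>] 0) (𝓝 0) := by
    have hz : Tendsto (fun t => K * (1 + 2 * Real.cosh 1) * √t) (𝓝[>] 0) (𝓝 0) := by
      have : Continuous fun t => K * (1 + 2 * Real.cosh 1) * √t := by fun_prop
      simpa using (this.tendsto 0).mono_left nhdsWithin_le_nhds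
    refine squeeze_zero_norm' ?_ hz
    filter_upwards [Ioc_mem_nhdsGT one_pos] with t ht
    have h2 := abs_integral_sub_mul_heat_le hn hc x hK hfx ht.1 ht.2
    have cH := continuous_heat_dot (n := n) ht.1 x
    simp only [sub_mul] at h2
    rwa [integral_sub (integrable_of_continuous (by fun_prop))
      (integrable_of_continuous (by fun_prop)), integral_const_mul, integral_heat hn x ht.1,
      h1 t ht.1] at h2
  have hlim' : Tendsto (fun t => polyFun p x * Real.exp (-halfDim n * t) -
      A * Real.exp (-(k + halfDim n) * t)) (𝓝[>] 0) (𝓝 (polyFun p x - A)) := by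
    have : Continuous fun t => polyFun p x * Real.exp (-halfDim n * t) -
      A * Real.exp (-(k + halfDim n) * t) := by fun_prop
    simpa using (this.tendsto 0).mono_left nhdsWithin_le_nhds
  have : A = polyFun p x := by linarith [tendsto_nhds_unique hlim hlim']
  rw [h1 t ht, this, mul_comm]

/-- Spherical harmonics are eigenfunctions of the semigroup. -/
theorem integral_mul_heat (hn : 3 ≤ n) {k : ℕ} {f : Sph n → ℝ} (hf : f ∈ SH n k) (x : Sph n)
    {t : ℝ} (ht : 0 < t) :
    ∫ y, f y * heat n t (dot x y) ∂(surf n) = Real.exp (-(k + halfDim n) * t) * f x := by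
  obtain ⟨p, ⟨hp, h0⟩, rfl⟩ := hf
  exact integral_polyFun_mul_heat hn hp h0 x ht

end ApproximateIdentity

/-! ### Expansion of smooth functions in spherical harmonics -/

section Expansion

variable {n : ℕ}

theorem smoothNear_radialExt {u : Sph n → ℝ} (hu : SmoothOnSphere u) :
    SmoothNear (radialExt u) := by
  obtain ⟨U, hU, hsub, h⟩ := hu
  exact fun x hx => h.contDiffAt (hU.mem_nhds (hsub hx))

theorem radialExt_coe (u : Sph n → ℝ) (x : Sph n) : radialExt u x = u x := by
  have h0 : (x : EuclideanSpace ℝ (Fin n)) ≠ 0 := ne_zero_of_mem_unit_sphere x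
  rw [radialExt, dif_neg h0]
  congr 1
  ext1
  simp

theorem two_mul_cosh_sub_two (t : ℝ) : 2 * Real.cosh t - 2 = (2 * Real.sinh (t / 2)) ^ 2 := by
  have h := Real.cosh_two_mul (t / 2)
  rw [mul_div_cancel₀ _ two_ne_zero, Real.cosh_sq] at h
  rw [h]; ring

theorem le_two_mul_sinh_half {t : ℝ} (ht : 0 ≤ t) : t ≤ 2 * Real.sinh (t / 2) := by
  have := Real.self_le_sinh_iff.2 (by positivity : 0 ≤ t / 2)
  linarith

/-- With s = 2 sinh(t/2) ≥ t one has 2 cosh t - 2τ ≥ s² and 2 sinh t ≤ 2s + s². The resulting powers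
of s have negative exponents as n ≥ 3, so s may be replaced by t. -/
theorem sphereArea_mul_heat_le (hn : 3 ≤ n) {t τ : ℝ} (ht : 0 < t) (hτ : τ ≤ 1) :
    sphereArea n * heat n t τ ≤ 2 * t ^ (1 - (n : ℝ)) + t ^ (2 - (n : ℝ)) := by
  have hω := sphereArea_pos hn
  have hn' : (3 : ℝ) ≤ n := by exact_mod_cast hn
  set s := 2 * Real.sinh (t / 2) with hs
  have hts : t ≤ s := le_two_mul_sinh_half ht.le
  have hs0 : 0 < s := lt_of_lt_of_le ht hts
  have hW := two_mul_cosh_sub_pos ht hτ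
  have h1 : s ^ 2 ≤ 2 * Real.cosh t - 2 * τ := by
    rw [hs, ← two_mul_cosh_sub_two]; linarith
  have h2 : s ^ (n : ℝ) ≤ (2 * Real.cosh t - 2 * τ) ^ ((n : ℝ) / 2) := by
    calc s ^ (n : ℝ) = (s ^ 2) ^ ((n : ℝ) / 2) := by
          rw [← Real.rpow_natCast, ← Real.rpow_mul hs0.le]; push_cast; ring_nf
      _ ≤ _ := Real.rpow_le_rpow (by positivity) h1 (by positivity)
  have h3 : 2 * Real.sinh t ≤ 2 * s + s ^ 2 := by
    have e1 := Real.sinh_two_mul (t / 2)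
    rw [mul_div_cancel₀ _ two_ne_zero] at e1
    have e2 := Real.cosh_sub_sinh (t / 2)
    have e3 : Real.exp (-(t / 2)) ≤ 1 := Real.exp_le_one_iff.2 (by linarith)
    rw [e1]
    nlinarith
  calc sphereArea n * heat n t τ = 2 * Real.sinh t / (2 * Real.cosh t - 2 * τ) ^ ((n : ℝ) / 2) := by
        rw [heat_eq ht hτ]; field_simp
    _ ≤ (2 * s + s ^ 2) / s ^ (n : ℝ) := by gcongr
    _ = 2 * s ^ (1 - (n : ℝ)) + s ^ (2 - (n : ℝ)) := by
        rw [Real.rpow_sub hs0, Real.rpow_sub hs0, Real.rpow_one, Real.rpow_two]; ring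
    _ ≤ _ := by
        gcongr 2 * ?_ + ?_
        · exact Real.rpow_le_rpow_of_nonpos ht hts (by linarith)
        · exact Real.rpow_le_rpow_of_nonpos ht hts (by linarith)

/-- The semigroup reproduces g up to the factor e^{(k+m)t}. At t = 1/(k+1) this factor is at most
e^{1+m}, while the kernel is at most 3(k+1)^{n-1}/ω. -/
theorem exists_abs_le_of_mem_SH (hn : 3 ≤ n) : ∃ C, 0 ≤ C ∧ ∀ k, ∀ g ∈ SH n k, ∀ x,
    |g x| ≤ C * ((k : ℝ) + 1) ^ (n - 1) * ∫ y, |g y| ∂(surf n) := by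
  have hω := sphereArea_pos hn
  have hm := halfDim_pos hn
  refine ⟨Real.exp (1 + halfDim n) * (3 / sphereArea n), by positivity, fun k g hg x => ?_⟩
  have hk : (0 : ℝ) < k + 1 := by positivity
  have ht : (0 : ℝ) < ((k : ℝ) + 1)⁻¹ := by positivity
  set t := ((k : ℝ) + 1)⁻¹ with htdef
  have h1 := integral_mul_heat hn hg x ht
  have hgc := continuous_of_mem_SH hg
  have hheat : ∀ y, heat n t (dot x y) ≤ 3 / sphereArea n * ((k : ℝ) + 1) ^ (n - 1) := by
    intro y
    have h2 := sphereArea_mul_heat_le hn ht (dot_le_one x y)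
    have e1 : t ^ (1 - (n : ℝ)) = ((k : ℝ) + 1) ^ (n - 1) := by
      rw [htdef, Real.inv_rpow hk.le, ← Real.rpow_neg hk.le, ← Real.rpow_natCast,
        Nat.cast_sub (by omega)]
      congr 1; push_cast; ring
    have e2 : t ^ (2 - (n : ℝ)) ≤ ((k : ℝ) + 1) ^ (n - 1) := by
      rw [htdef, Real.inv_rpow hk.le, ← Real.rpow_neg hk.le, ← Real.rpow_natCast,
        Nat.cast_sub (by omega)]
      refine Real.rpow_le_rpow_of_exponent_le (by linarith [Nat.cast_nonneg (α := ℝ) k]) ?_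
      push_cast; linarith
    rw [div_mul_eq_mul_div, le_div_iff₀ hω]
    linarith
  have h3 : |∫ y, g y * heat n t (dot x y) ∂(surf n)| ≤
      3 / sphereArea n * ((k : ℝ) + 1) ^ (n - 1) * ∫ y, |g y| ∂(surf n) := by
    rw [← integral_const_mul]
    refine abs_integral_le_integral_abs.trans (integral_mono
      (integrable_of_continuous (hgc.mul (continuous_heat_dot ht x)).abs)
      (integrable_of_continuous (hgc.abs.const_mul _)) fun y => ?_)
    change |g y * heat n t (dot x y)| ≤ _
    rw [abs_mul, abs_of_nonneg (heat_nonneg hn ht (dot_le_one x y)), mul_comm]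
    exact mul_le_mul_of_nonneg_right (hheat y) (abs_nonneg _)
  have h4 : (k + halfDim n) * t ≤ 1 + halfDim n := by
    rw [htdef, ← div_eq_mul_inv, div_le_iff₀ hk]
    nlinarith [Nat.cast_nonneg (α := ℝ) k]
  have hI : 0 ≤ ∫ y, |g y| ∂(surf n) := integral_nonneg fun _ => abs_nonneg _
  calc |g x| = Real.exp ((k + halfDim n) * t) * |∫ y, g y * heat n t (dot x y) ∂(surf n)| := by
        rw [h1, abs_mul, Real.abs_exp, ← mul_assoc, ← Real.exp_add,
          show (k + halfDim n) * t + -(k + halfDim n) * t = 0 by ring, Real.exp_zero, one_mul]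
    _ ≤ Real.exp (1 + halfDim n) *
        (3 / sphereArea n * ((k : ℝ) + 1) ^ (n - 1) * ∫ y, |g y| ∂(surf n)) := by gcongr
    _ = _ := by ring

variable (B : SHBasis n)

theorem SHBasis.mem_SH (k : ℕ) (l : Fin (Module.finrank ℝ (SH n k))) : B.Y k l ∈ SH n k := by
  rw [← B.span_eq k]
  exact Submodule.subset_span ⟨l, rfl⟩

theorem SHBasis.continuous_Y (k : ℕ) (l : Fin (Module.finrank ℝ (SH n k))) :
    Continuous (B.Y k l) :=
  continuous_of_mem_SH (B.mem_SH k l)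

theorem SHBasis.proj_mem_SH (k : ℕ) (u : Sph n → ℝ) : B.proj k u ∈ SH n k := by
  have : B.proj k u = ∑ l, B.coeff k l u • B.Y k l := by
    ext x; simp [SHBasis.proj]
  rw [this]
  exact Submodule.sum_mem _ fun l _ => Submodule.smul_mem _ _ (B.mem_SH k l)

theorem SHBasis.continuous_proj (k : ℕ) (u : Sph n → ℝ) : Continuous (B.proj k u) :=
  continuous_of_mem_SH (B.proj_mem_SH k u)

theorem SHBasis.integral_proj_mul_Y (k : ℕ) (u : Sph n → ℝ)
    (l : Fin (Module.finrank ℝ (SH n k))) :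
    ∫ y, B.proj k u y * B.Y k l y ∂(surf n) = B.coeff k l u := by
  simp only [SHBasis.proj, Finset.sum_mul, mul_assoc]
  rw [integral_finsetSum _ fun i _ => (integrable_mul_of_continuous (B.continuous_Y k i)
    (B.continuous_Y k l)).const_mul _]
  simp only [integral_const_mul, B.orthonormal]
  simp

/-- `P_k u` is the orthogonal projection of `u` to the spherical harmonics of degree `k`. -/
theorem SHBasis.integral_proj_mul {k : ℕ} {u : Sph n → ℝ} (hu : Continuous u) {g : Sph n → ℝ}
    (hg : g ∈ SH n k) :
    ∫ y, B.proj k u y * g y ∂(surf n) = ∫ y, u y * g y ∂(surf n) := by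
  rw [← B.span_eq k] at hg
  suffices Continuous g ∧ ∫ y, B.proj k u y * g y ∂(surf n) = ∫ y, u y * g y ∂(surf n) from this.2
  have hp := B.continuous_proj k u
  induction hg using Submodule.span_induction with
  | mem g hg =>
    obtain ⟨l, rfl⟩ := hg
    exact ⟨B.continuous_Y k l, B.integral_proj_mul_Y k u l⟩
  | zero => exact ⟨continuous_zero, by simp⟩
  | add f g _ _ hf hg =>
    refine ⟨hf.1.add hg.1, ?_⟩
    simp only [Pi.add_apply, mul_add]
    rw [integral_add (integrable_mul_of_continuous hp hf.1) (integrable_mul_of_continuous hp hg.1),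
      integral_add (integrable_mul_of_continuous hu hf.1) (integrable_mul_of_continuous hu hg.1),
      hf.2, hg.2]
  | smul c f _ hf =>
    refine ⟨hf.1.const_smul c, ?_⟩
    simp only [Pi.smul_apply, smul_eq_mul, mul_left_comm _ c, integral_const_mul, hf.2]

theorem SHBasis.integral_proj_sq_le (k : ℕ) {u : Sph n → ℝ} (hu : Continuous u) :
    ∫ y, B.proj k u y * B.proj k u y ∂(surf n) ≤ ∫ y, u y * u y ∂(surf n) := by
  have hp := B.continuous_proj k u
  have h1 := B.integral_proj_mul hu (B.proj_mem_SH k u)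
  have h2 : 0 ≤ ∫ y, (u y - B.proj k u y) * (u y - B.proj k u y) ∂(surf n) :=
    integral_nonneg fun y => mul_self_nonneg _
  have h3 : ∀ y, (u y - B.proj k u y) * (u y - B.proj k u y) =
      u y * u y - 2 * (u y * B.proj k u y) + B.proj k u y * B.proj k u y := fun y => by ring
  simp only [h3] at h2
  have i1 : Integrable (fun y => u y * u y - 2 * (u y * B.proj k u y)) (surf n) :=
    (integrable_mul_of_continuous hu hu).sub ((integrable_mul_of_continuous hu hp).const_mul 2)
  rw [integral_add i1 (integrable_mul_of_continuous hp hp),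
    integral_sub (integrable_mul_of_continuous hu hu)
      ((integrable_mul_of_continuous hu hp).const_mul 2), integral_const_mul] at h2
  linarith

theorem SHBasis.exists_abs_proj_le (hn : 3 ≤ n) {u : Sph n → ℝ} (hu : Continuous u) :
    ∃ D, 0 ≤ D ∧ ∀ k x, |B.proj k u x| ≤ D * ((k : ℝ) + 1) ^ (n - 1) := by
  obtain ⟨C, hC, h⟩ := exists_abs_le_of_mem_SH hn
  have hI : 0 ≤ ∫ y, u y * u y ∂(surf n) := integral_nonneg fun y => mul_self_nonneg _
  have hω := sphereArea_pos hn
  refine ⟨C * (sphereArea n + ∫ y, u y * u y ∂(surf n)), by positivity, fun k x => ?_⟩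
  have hp := B.continuous_proj k u
  have h1 : ∫ y, |B.proj k u y| ∂(surf n) ≤ sphereArea n + ∫ y, u y * u y ∂(surf n) := by
    -- The inequality |v| ≤ 1 + v² passes from L¹ to L², where Bessel's inequality applies.
    calc ∫ y, |B.proj k u y| ∂(surf n) ≤ ∫ y, (1 + B.proj k u y * B.proj k u y) ∂(surf n) := by
          refine integral_mono (integrable_of_continuous hp.abs)
            ((integrable_const _).add (integrable_mul_of_continuous hp hp)) fun y => ?_
          change |B.proj k u y| ≤ 1 + B.proj k u y * B.proj k u y
          rw [← abs_mul_abs_self]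
          nlinarith [sq_nonneg (|B.proj k u y| - 1), abs_nonneg (B.proj k u y)]
      _ = sphereArea n + ∫ y, B.proj k u y * B.proj k u y ∂(surf n) := by
          rw [integral_add (integrable_const _) (integrable_mul_of_continuous hp hp),
            integral_const, surf_univ hn]
          simp
      _ ≤ _ := by linarith [B.integral_proj_sq_le k hu]
  calc |B.proj k u x| ≤ C * ((k : ℝ) + 1) ^ (n - 1) * ∫ y, |B.proj k u y| ∂(surf n) :=
        h k _ (B.proj_mem_SH k u) x
    _ ≤ C * ((k : ℝ) + 1) ^ (n - 1) * (sphereArea n + ∫ y, u y * u y ∂(surf n)) := by gcongr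
    _ = _ := by ring

/-- The spherical Laplacian is self-adjoint and acts on spherical harmonics as a scalar. -/
theorem integral_sphLap_mul_of_mem_SH {f : EuclideanSpace ℝ (Fin n) → ℝ} (hf : SmoothNear f)
    {k : ℕ} {g : Sph n → ℝ} (hg : g ∈ SH n k) :
    ∫ y : Sph n, sphLap f y * g y ∂(surf n) =
      -((k : ℝ) * (k + n - 2)) * ∫ y : Sph n, f y * g y ∂(surf n) := by
  obtain ⟨p, ⟨hp, h0⟩, rfl⟩ := hg
  simp only [restrictToSphere_apply]
  rw [integral_sphLap_mul hf (smoothNear_polyFun p), ← integral_const_mul]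
  simp only [sphLap_polyFun hp h0]
  refine integral_congr_ae (.of_forall fun y => ?_)
  change _ * (_ * _) = _ * (_ * _)
  ring

theorem SHBasis.proj_sphLap {f : EuclideanSpace ℝ (Fin n) → ℝ} (hf : SmoothNear f) (k : ℕ)
    (x : Sph n) : B.proj k (fun y => sphLap f y) x =
      -((k : ℝ) * (k + n - 2)) * B.proj k (fun y => f y) x := by
  simp only [SHBasis.proj, SHBasis.coeff, integral_sphLap_mul_of_mem_SH hf (B.mem_SH k _),
    Finset.mul_sum, mul_assoc]

/-- Eigenfunctions of the self-adjoint Laplacian; the eigenvalues differ by (j - k)(j + k + n - 2),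
up to sign, which is nonzero. -/
theorem integral_mul_eq_zero_of_mem_SH (hn : 3 ≤ n) {j k : ℕ} (hjk : j ≠ k) {f g : Sph n → ℝ}
    (hf : f ∈ SH n j) (hg : g ∈ SH n k) : ∫ y, f y * g y ∂(surf n) = 0 := by
  obtain ⟨p, ⟨hp, h0⟩, rfl⟩ := hf
  have h1 := integral_sphLap_mul_of_mem_SH (smoothNear_polyFun p) hg
  simp only [sphLap_polyFun hp h0, mul_assoc, integral_const_mul] at h1
  simp only [restrictToSphere_apply]
  have h2 : ((j : ℝ) - k) * (j + k + n - 2) *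
      ∫ y : Sph n, polyFun p y * g y ∂(surf n) = 0 := by linear_combination -h1
  have hn' : (3 : ℝ) ≤ n := by exact_mod_cast hn
  have h3 : ((j : ℝ) - k) ≠ 0 := sub_ne_zero.2 (by exact_mod_cast hjk)
  have h4 : (0 : ℝ) < j + k + n - 2 := by
    have := Nat.cast_nonneg (α := ℝ) j
    have := Nat.cast_nonneg (α := ℝ) k
    linarith
  exact (mul_eq_zero.1 h2).resolve_left (mul_ne_zero h3 h4.ne')

/-- Each Laplacian multiplies P_k f by -k(k+n-2), so the left side is |P_k| of the j-th Laplacian of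
f, again smooth. -/
theorem SHBasis.exists_abs_proj_mul_pow_le (hn : 3 ≤ n) (j : ℕ)
    {f : EuclideanSpace ℝ (Fin n) → ℝ} (hf : SmoothNear f) :
    ∃ D, 0 ≤ D ∧ ∀ k x, |B.proj k (fun y => f y) x| * ((k : ℝ) * (k + n - 2)) ^ j ≤
      D * ((k : ℝ) + 1) ^ (n - 1) := by
  induction j generalizing f with
  | zero => simpa using B.exists_abs_proj_le hn hf.continuous
  | succ j ih =>
    obtain ⟨D, hD, h⟩ := ih hf.sphLap
    refine ⟨D, hD, fun k x => ?_⟩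
    have hn' : (3 : ℝ) ≤ n := by exact_mod_cast hn
    have hk : 0 ≤ (k : ℝ) * (k + n - 2) :=
      mul_nonneg (Nat.cast_nonneg k) (by linarith [Nat.cast_nonneg (α := ℝ) k])
    have h1 := h k x
    rw [B.proj_sphLap hf, abs_mul, abs_neg, abs_of_nonneg hk] at h1
    refine le_of_eq_of_le ?_ h1
    ring

/-- The components of a smooth function in the spherical harmonics decay rapidly. -/
theorem SHBasis.exists_abs_proj_le_div (hn : 3 ≤ n) {f : EuclideanSpace ℝ (Fin n) → ℝ}
    (hf : SmoothNear f) :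
    ∃ D, 0 ≤ D ∧ ∀ k x, |B.proj k (fun y => f y) x| ≤ D / ((k : ℝ) + 1) ^ 3 := by
  obtain ⟨D, hD, h⟩ := B.exists_abs_proj_mul_pow_le hn n hf
  obtain ⟨D', hD', h'⟩ := B.exists_abs_proj_le hn hf.continuous
  -- For k ≥ 1, k(k+n-2) ≥ (k+1)²/4, so n Laplacians gain (k+1)^{2n}/4^n against the growth
  -- (k+1)^{n-1}, leaving (k+1)^{-(n+1)}. The eigenvalue vanishes at k = 0, where D' serves.
  refine ⟨max (4 ^ n * D) D', le_max_of_le_right hD', fun k x => ?_⟩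
  rcases Nat.eq_zero_or_pos k with rfl | hk
  · simpa using Or.inr (by simpa using h' 0 x)
  · have hk' : (1 : ℝ) ≤ k := by exact_mod_cast hk
    have hn' : (3 : ℝ) ≤ n := by exact_mod_cast hn
    have h1 : (((k : ℝ) + 1) ^ 2 / 4) ^ n ≤ ((k : ℝ) * (k + n - 2)) ^ n := by
      refine pow_le_pow_left₀ (by positivity) ?_ n
      nlinarith
    have h2 : |B.proj k (fun y => f y) x| * (((k : ℝ) + 1) ^ 2 / 4) ^ n ≤
        D * ((k : ℝ) + 1) ^ (n - 1) :=
      (mul_le_mul_of_nonneg_left h1 (abs_nonneg _)).trans (h k x)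
    have h3 : (((k : ℝ) + 1) ^ 2 / 4) ^ n = ((k : ℝ) + 1) ^ (n - 1) * ((k : ℝ) + 1) ^ (n + 1) / 4 ^ n := by
      rw [div_pow, ← pow_mul, ← pow_add]
      congr 2; omega
    rw [h3, mul_div_assoc', div_le_iff₀ (by positivity), ← mul_assoc, mul_right_comm,
      mul_right_comm D, mul_comm] at h2
    have h4 := le_of_mul_le_mul_left (h2.trans_eq (mul_comm _ _)) (by positivity)
    rw [le_div_iff₀ (by positivity)]
    calc |B.proj k (fun y => f y) x| * ((k : ℝ) + 1) ^ 3
        ≤ |B.proj k (fun y => f y) x| * ((k : ℝ) + 1) ^ (n + 1) := by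
          gcongr
          · linarith
          · omega
      _ ≤ 4 ^ n * D := by linarith
      _ ≤ _ := le_max_left _ _

theorem summable_div_add_one_pow (D : ℝ) {j : ℕ} (hj : 2 ≤ j) :
    Summable fun k : ℕ => D / ((k : ℝ) + 1) ^ j := by
  have h := (summable_nat_add_iff 1).2 (Real.summable_nat_pow_inv.2 (by omega : 1 < j))
  simpa [div_eq_mul_inv] using h.mul_left D

theorem hasSum_integral_mul_of_le {g : ℕ → Sph n → ℝ} (hg : ∀ k, Continuous (g k)) {D : ℝ}
    (hD : ∀ k x, |g k x| ≤ D / ((k : ℝ) + 1) ^ 3) {w : Sph n → ℝ} (hw : Continuous w) :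
    HasSum (fun k => ∫ y, g k y * w y ∂(surf n)) (∫ y, (∑' k, g k y) * w y ∂(surf n)) := by
  have hs := summable_div_add_one_pow D (j := 3) (by norm_num)
  obtain ⟨M, hM⟩ := isCompact_univ.exists_bound_of_continuousOn hw.continuousOn
  have h1 := hasSum_integral_of_summable_integral_norm (μ := surf n)
    (F := fun k y => g k y * w y) (fun k => integrable_mul_of_continuous (hg k) hw) (by
      refine Summable.of_nonneg_of_le (fun k => integral_nonneg fun y => norm_nonneg _)
        (fun k => ?_) (hs.mul_right (M * (surf n).real Set.univ))
      calc ∫ y, ‖g k y * w y‖ ∂(surf n) ≤ ∫ _y : Sph n, D / ((k : ℝ) + 1) ^ 3 * M ∂(surf n) := by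
            refine integral_mono (integrable_of_continuous ((hg k).mul hw).norm)
              (integrable_const _) fun y => ?_
            change ‖g k y * w y‖ ≤ D / ((k : ℝ) + 1) ^ 3 * M
            rw [norm_mul]
            exact mul_le_mul (hD k y) (hM y trivial) (norm_nonneg _)
              ((abs_nonneg _).trans (hD k y))
        _ = _ := by rw [integral_const, smul_eq_mul]; ring)
  simpa only [tsum_mul_right] using h1

/-- A smooth function is the sum of its spherical harmonic expansion. -/
theorem SHBasis.hasSum_proj (hn : 3 ≤ n) {f : EuclideanSpace ℝ (Fin n) → ℝ} (hf : SmoothNear f)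
    (x : Sph n) : HasSum (fun k => B.proj k (fun y => f y) x) (f x) := by
  obtain ⟨D, hD, h⟩ := B.exists_abs_proj_le_div hn hf
  have hs := summable_div_add_one_pow D (j := 3) (by norm_num)
  have hc : Continuous fun x => ∑' k, B.proj k (fun y => f y) x :=
    continuous_tsum (fun k => B.continuous_proj k _) hs fun k x => h k x
  -- The remainder is continuous by uniform convergence. Tested against degree j, only the term k =
  -- j of the series survives and it cancels f, so completeness applies.
  have hz : (fun x : Sph n => f x - ∑' k, B.proj k (fun y => f y) x) = 0 := by
    refine eq_zero_of_forall_integral_eq_zero (by omega) (hf.continuous.sub hc) fun j g hg => ?_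
    have hgc := continuous_of_mem_SH hg
    have h1 := hasSum_integral_mul_of_le (fun k => B.continuous_proj k _) h hgc
    have h2 : ∫ y, (∑' k, B.proj k (fun y => f y) y) * g y ∂(surf n) =
        ∫ y : Sph n, f y * g y ∂(surf n) := by
      rw [← B.integral_proj_mul hf.continuous hg]
      refine h1.unique (hasSum_single j fun k hk => ?_)
      exact integral_mul_eq_zero_of_mem_SH hn hk (B.proj_mem_SH k _) hg
    simp only [sub_mul]
    rw [integral_sub (integrable_mul_of_continuous hf.continuous hgc)
      (integrable_mul_of_continuous hc hgc), h2, sub_self]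
  have hx := congrFun hz x
  have hsum : Summable fun k => B.proj k (fun y => f y) x :=
    Summable.of_norm_bounded hs fun k => h k x
  rw [show f x = ∑' k, B.proj k (fun y => f y) x from sub_eq_zero.1 hx]
  exact hsum.hasSum

/-- The expansion of the semigroup applied to a smooth function. -/
theorem SHBasis.hasSum_integral_mul_heat (hn : 3 ≤ n) {f : EuclideanSpace ℝ (Fin n) → ℝ}
    (hf : SmoothNear f) (x : Sph n) {t : ℝ} (ht : 0 < t) :
    HasSum (fun k : ℕ => Real.exp (-(k + halfDim n) * t) * B.proj k (fun y => f y) x)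
      (∫ y : Sph n, f y * heat n t (dot x y) ∂(surf n)) := by
  obtain ⟨D, hD, h⟩ := B.exists_abs_proj_le_div hn hf
  have h1 := hasSum_integral_mul_of_le (fun k => B.continuous_proj k _) h
    (continuous_heat_dot (n := n) ht x)
  simp only [fun y => (B.hasSum_proj hn hf y).tsum_eq,
    integral_mul_heat hn (B.proj_mem_SH _ _) x ht] at h1
  exact h1

end Expansion

/-! ### Two-sided bounds for the kernel -/

section KernelBounds

variable {n : ℕ}

theorem sphereArea_mul_heat_le_of_le_two (hn : 3 ≤ n) {t τ δ : ℝ} (ht : 0 < t) (ht2 : t ≤ 2)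
    (hδ : 0 < δ) (hτ : δ ^ 2 = 2 - 2 * τ) :
    sphereArea n * heat n t τ ≤ 2 * Real.cosh 2 * t / δ ^ (n : ℝ) := by
  have hω := sphereArea_pos hn
  have hτ1 : τ ≤ 1 := by nlinarith
  have h1 : δ ^ 2 ≤ 2 * Real.cosh t - 2 * τ := by linarith [two_lt_two_mul_cosh ht]
  have h2 : δ ^ (n : ℝ) ≤ (2 * Real.cosh t - 2 * τ) ^ ((n : ℝ) / 2) := by
    calc δ ^ (n : ℝ) = (δ ^ 2) ^ ((n : ℝ) / 2) := by
          rw [← Real.rpow_natCast, ← Real.rpow_mul hδ.le]; push_cast; ring_nf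
      _ ≤ _ := Real.rpow_le_rpow (by positivity) h1 (by positivity)
  have h3 : Real.sinh t ≤ t * Real.cosh 2 := by
    refine (sinh_le_mul_cosh ht.le).trans (mul_le_mul_of_nonneg_left ?_ ht.le)
    exact Real.cosh_le_cosh.2 (by rw [abs_of_pos ht, abs_of_pos two_pos]; exact ht2)
  calc sphereArea n * heat n t τ = 2 * Real.sinh t / (2 * Real.cosh t - 2 * τ) ^ ((n : ℝ) / 2) := by
        rw [heat_eq ht hτ1]; field_simp
    _ ≤ 2 * (t * Real.cosh 2) / δ ^ (n : ℝ) := by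
        have := Real.sinh_pos_iff.2 ht
        gcongr
    _ = _ := by ring

/-- In the window δ ≤ t ≤ 2δ the base 2 cosh t - 2τ = δ² + 4 sinh²(t/2) is comparable with δ²; cosh
2 enters because t/2 ≤ δ ≤ 2. -/
theorem le_sphereArea_mul_heat (hn : 3 ≤ n) {t τ δ : ℝ} (hδ : 0 < δ) (hδ2 : δ ≤ 2)
    (hτ : δ ^ 2 = 2 - 2 * τ) (h1t : δ ≤ t) (h2t : t ≤ 2 * δ) :
    2 * δ / (((1 + 4 * Real.cosh 2 ^ 2) ^ ((n : ℝ) / 2)) * δ ^ (n : ℝ)) ≤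
      sphereArea n * heat n t τ := by
  have hω := sphereArea_pos hn
  have hτ1 : τ ≤ 1 := by nlinarith
  have ht : 0 < t := hδ.trans_le h1t
  have hW := two_mul_cosh_sub_pos ht hτ1
  have h3 : Real.sinh (t / 2) ≤ t / 2 * Real.cosh 2 := by
    refine (sinh_le_mul_cosh (by positivity)).trans (mul_le_mul_of_nonneg_left ?_ (by positivity))
    exact Real.cosh_le_cosh.2 (by rw [abs_of_pos (by positivity), abs_of_pos two_pos]; linarith)
  have h1 : 2 * Real.cosh t - 2 * τ ≤ (1 + 4 * Real.cosh 2 ^ 2) * δ ^ 2 := by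
    have e1 := two_mul_cosh_sub_two t
    have e2 : (2 * Real.sinh (t / 2)) ^ 2 ≤ (2 * δ * Real.cosh 2) ^ 2 := by
      have : 0 ≤ Real.sinh (t / 2) := Real.sinh_nonneg_iff.2 (by positivity)
      refine pow_le_pow_left₀ (by positivity) ?_ 2
      calc 2 * Real.sinh (t / 2) ≤ t * Real.cosh 2 := by linarith
        _ ≤ 2 * δ * Real.cosh 2 := mul_le_mul_of_nonneg_right h2t (Real.cosh_pos 2).le
    nlinarith
  have h2 : (2 * Real.cosh t - 2 * τ) ^ ((n : ℝ) / 2) ≤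
      (1 + 4 * Real.cosh 2 ^ 2) ^ ((n : ℝ) / 2) * δ ^ (n : ℝ) := by
    calc (2 * Real.cosh t - 2 * τ) ^ ((n : ℝ) / 2)
        ≤ ((1 + 4 * Real.cosh 2 ^ 2) * δ ^ 2) ^ ((n : ℝ) / 2) :=
          Real.rpow_le_rpow hW.le h1 (by positivity)
      _ = _ := by
          rw [Real.mul_rpow (by positivity) (by positivity), ← Real.rpow_natCast δ 2,
            ← Real.rpow_mul hδ.le]
          push_cast; ring_nf
  have h4 : δ ≤ Real.sinh t := h1t.trans (Real.self_le_sinh_iff.2 ht.le)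
  calc _ ≤ 2 * Real.sinh t / (2 * Real.cosh t - 2 * τ) ^ ((n : ℝ) / 2) := by gcongr
    _ = sphereArea n * heat n t τ := by rw [heat_eq ht hτ1]; field_simp

theorem kernelIntegrand_nonneg (hn : 3 ≤ n) (a : ℝ) {t τ : ℝ} (ht : 0 < t) (hτ : τ ≤ 1) :
    0 ≤ kernelIntegrand n a τ t :=
  div_nonneg (heat_nonneg hn ht hτ) (Real.rpow_nonneg ht.le _)

theorem continuousOn_kernelIntegrand (a : ℝ) (x : Sph n) : ContinuousOn
    (fun q : ℝ × Sph n => kernelIntegrand n a (dot x q.2) q.1) (Set.Ioi 0 ×ˢ Set.univ) := by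
  refine (ContinuousOn.comp_dot continuousOn_heat x).div
    (continuousOn_fst.rpow_const fun q hq => Or.inl (ne_of_gt hq.1)) fun q hq => ?_
  exact (Real.rpow_pos_of_pos hq.1 _).ne'

theorem aestronglyMeasurable_kernelIntegrand (a : ℝ) (x y : Sph n) :
    AEStronglyMeasurable (kernelIntegrand n a (dot x y)) (volume.restrict (Set.Ioi 0)) := by
  refine ContinuousOn.aestronglyMeasurable ?_ measurableSet_Ioi
  exact (continuousOn_kernelIntegrand a x).comp (f := fun t => (t, y)) (by fun_prop)
    fun t ht => ⟨ht, trivial⟩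

theorem kernelIntegrand_le_of_le (hn : 3 ≤ n) (a : ℝ) {t τ δ : ℝ} (ht : 0 < t) (htδ : t ≤ δ)
    (hδ2 : δ ≤ 2) (hτ : δ ^ 2 = 2 - 2 * τ) :
    kernelIntegrand n a τ t ≤ 2 * Real.cosh 2 / sphereArea n * δ ^ (-(n : ℝ)) * t ^ (-a) := by
  have hω := sphereArea_pos hn
  have hδ : 0 < δ := ht.trans_le htδ
  have h := sphereArea_mul_heat_le_of_le_two hn ht (htδ.trans hδ2) hδ hτ
  change heat n t τ / t ^ (1 + a) ≤ _
  have h' : heat n t τ ≤ 2 * Real.cosh 2 * t / δ ^ (n : ℝ) / sphereArea n := by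
    rw [le_div_iff₀ hω]; linarith
  calc heat n t τ / t ^ (1 + a) ≤ 2 * Real.cosh 2 * t / δ ^ (n : ℝ) / sphereArea n / t ^ (1 + a) := by
        gcongr
    _ = _ := by
        rw [Real.rpow_neg hδ.le, Real.rpow_neg ht.le, Real.rpow_add ht, Real.rpow_one]
        field_simp

theorem kernelIntegrand_le (hn : 3 ≤ n) (a : ℝ) {t τ : ℝ} (ht : 0 < t) (hτ : τ ≤ 1) :
    kernelIntegrand n a τ t ≤
      (sphereArea n)⁻¹ * (2 * t ^ (-(n : ℝ) - a) + t ^ (1 - (n : ℝ) - a)) := by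
  have hω := sphereArea_pos hn
  have h := sphereArea_mul_heat_le hn ht hτ
  change heat n t τ / t ^ (1 + a) ≤ _
  have h' : heat n t τ ≤ (2 * t ^ (1 - (n : ℝ)) + t ^ (2 - (n : ℝ))) / sphereArea n := by
    rw [le_div_iff₀ hω]; linarith
  calc heat n t τ / t ^ (1 + a)
      ≤ (2 * t ^ (1 - (n : ℝ)) + t ^ (2 - (n : ℝ))) / sphereArea n / t ^ (1 + a) := by gcongr
    _ = (sphereArea n)⁻¹ * (2 * (t ^ (1 - (n : ℝ)) / t ^ (1 + a)) +
          t ^ (2 - (n : ℝ)) / t ^ (1 + a)) := by ring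
    _ = _ := by
        rw [← Real.rpow_sub ht, ← Real.rpow_sub ht]
        ring_nf

theorem integrableOn_rpow_Ioc {r : ℝ} (hr : -1 < r) {c : ℝ} (hc : 0 ≤ c) :
    IntegrableOn (fun t : ℝ => t ^ r) (Set.Ioc 0 c) :=
  (intervalIntegrable_iff_integrableOn_Ioc_of_le hc).1 (intervalIntegral.intervalIntegrable_rpow' hr)

theorem integral_rpow_Ioc {r : ℝ} (hr : -1 < r) {c : ℝ} (hc : 0 ≤ c) :
    ∫ t in Set.Ioc 0 c, t ^ r = c ^ (r + 1) / (r + 1) := by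
  rw [← intervalIntegral.integral_of_le hc, integral_rpow (Or.inl hr),
    Real.zero_rpow (by linarith), sub_zero]

/-- The integral is split at t = δ. Convergence at 0 needs a < 1; at infinity a > -1 suffices since
n ≥ 3. Negative a is allowed because the Fubini argument uses the exponent a - 1. -/
theorem integral_kernelIntegrand_le (hn : 3 ≤ n) {a : ℝ} (ha : -1 < a) (ha1 : a < 1)
    {x y : Sph n} {δ : ℝ} (hδ : 0 < δ) (hδ2 : δ ≤ 2) (hτ : δ ^ 2 = 2 - 2 * dot x y) :
    IntegrableOn (kernelIntegrand n a (dot x y)) (Set.Ioi 0) ∧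
      ∫ t in Set.Ioi 0, kernelIntegrand n a (dot x y) t ≤
        (2 * Real.cosh 2 / sphereArea n / (1 - a) +
          (sphereArea n)⁻¹ * (2 / (n - 1 + a) + 2 / (n - 2 + a))) * δ ^ (1 - (n : ℝ) - a) := by
  have hω := sphereArea_pos hn
  have hn' : (3 : ℝ) ≤ n := by exact_mod_cast hn
  have hτ1 := dot_le_one x y
  have hmeas := aestronglyMeasurable_kernelIntegrand (n := n) a x y
  have hsplit : Set.Ioc 0 δ ∪ Set.Ioi δ = Set.Ioi (0 : ℝ) := Set.Ioc_union_Ioi_eq_Ioi hδ.le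
  have d1 : IntegrableOn (fun t : ℝ => 2 * Real.cosh 2 / sphereArea n * δ ^ (-(n : ℝ)) * t ^ (-a))
      (Set.Ioc 0 δ) := (integrableOn_rpow_Ioc (by linarith) hδ.le).const_mul _
  have d2a : IntegrableOn (fun t : ℝ => t ^ (-(n : ℝ) - a)) (Set.Ioi δ) :=
    integrableOn_Ioi_rpow_of_lt (by linarith) hδ
  have d2b : IntegrableOn (fun t : ℝ => t ^ (1 - (n : ℝ) - a)) (Set.Ioi δ) :=
    integrableOn_Ioi_rpow_of_lt (by linarith) hδ
  have d2 : IntegrableOn (fun t : ℝ => (sphereArea n)⁻¹ *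
      (2 * t ^ (-(n : ℝ) - a) + t ^ (1 - (n : ℝ) - a))) (Set.Ioi δ) :=
    ((d2a.const_mul 2).add d2b).const_mul _
  have b1 : ∀ t ∈ Set.Ioc 0 δ, kernelIntegrand n a (dot x y) t ≤
      2 * Real.cosh 2 / sphereArea n * δ ^ (-(n : ℝ)) * t ^ (-a) :=
    fun t ht => kernelIntegrand_le_of_le hn a ht.1 ht.2 hδ2 hτ
  have b2 : ∀ t ∈ Set.Ioi δ, kernelIntegrand n a (dot x y) t ≤ (sphereArea n)⁻¹ *
      (2 * t ^ (-(n : ℝ) - a) + t ^ (1 - (n : ℝ) - a)) :=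
    fun t ht => kernelIntegrand_le hn a (hδ.trans ht) hτ1
  have i1 : IntegrableOn (kernelIntegrand n a (dot x y)) (Set.Ioc 0 δ) := by
    refine Integrable.mono' d1 (hmeas.mono_measure (Measure.restrict_mono
      (Set.Ioc_subset_Ioi_self) le_rfl)) ?_
    filter_upwards [ae_restrict_mem measurableSet_Ioc] with t ht
    rw [Real.norm_of_nonneg (kernelIntegrand_nonneg hn a ht.1 hτ1)]
    exact b1 t ht
  have i2 : IntegrableOn (kernelIntegrand n a (dot x y)) (Set.Ioi δ) := by
    refine Integrable.mono' d2 (hmeas.mono_measure (Measure.restrict_mono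
      (Set.Ioi_subset_Ioi hδ.le) le_rfl)) ?_
    filter_upwards [ae_restrict_mem measurableSet_Ioi] with t ht
    rw [Real.norm_of_nonneg (kernelIntegrand_nonneg hn a (hδ.trans ht) hτ1)]
    exact b2 t ht
  refine ⟨hsplit ▸ i1.union i2, ?_⟩
  rw [← hsplit, setIntegral_union (Set.Ioc_disjoint_Ioi le_rfl) measurableSet_Ioi i1 i2]
  have j1 : ∫ t in Set.Ioc 0 δ, kernelIntegrand n a (dot x y) t ≤
      2 * Real.cosh 2 / sphereArea n / (1 - a) * δ ^ (1 - (n : ℝ) - a) := by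
    refine (setIntegral_mono_on i1 d1 measurableSet_Ioc b1).trans_eq ?_
    have e : δ ^ (1 - (n : ℝ) - a) = δ ^ (-(n : ℝ)) * δ ^ (-a + 1) := by
      rw [← Real.rpow_add hδ]; ring_nf
    rw [integral_const_mul, integral_rpow_Ioc (by linarith) hδ.le, e]
    ring
  have j2 : ∫ t in Set.Ioi δ, kernelIntegrand n a (dot x y) t ≤
      (sphereArea n)⁻¹ * (2 / (n - 1 + a) + 2 / (n - 2 + a)) * δ ^ (1 - (n : ℝ) - a) := by
    refine (setIntegral_mono_on i2 d2 measurableSet_Ioi b2).trans ?_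
    rw [integral_const_mul, integral_add (d2a.const_mul 2) d2b, integral_const_mul,
      integral_Ioi_rpow_of_lt (by linarith) hδ, integral_Ioi_rpow_of_lt (by linarith) hδ, mul_assoc]
    refine mul_le_mul_of_nonneg_left ?_ (by positivity)
    have e1 : -(n : ℝ) - a + 1 = 1 - n - a := by ring
    -- The lower-order term has one extra power of δ, absorbed by δ ≤ 2.
    have e2 : δ ^ (1 - (n : ℝ) - a + 1) ≤ 2 * δ ^ (1 - (n : ℝ) - a) := by
      rw [Real.rpow_add_one hδ.ne', mul_comm]
      gcongr
    have p1 : 0 < (n : ℝ) - 1 + a := by linarith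
    have p2 : 0 < (n : ℝ) - 2 + a := by linarith
    rw [e1, add_mul]
    refine add_le_add (le_of_eq ?_) ?_
    · rw [show 1 - (n : ℝ) - a = -(n - 1 + a) by ring, neg_div_neg_eq]
      ring
    · rw [show 1 - (n : ℝ) - a + 1 = -(n - 2 + a) by ring, neg_div_neg_eq, div_mul_eq_mul_div]
      rw [show 1 - (n : ℝ) - a + 1 = -(n - 2 + a) by ring] at e2
      gcongr
  linarith

theorem le_integral_kernelIntegrand (hn : 3 ≤ n) {a : ℝ} (ha : -1 < a) (ha1 : a < 1)
    {x y : Sph n} {δ : ℝ} (hδ : 0 < δ) (hδ2 : δ ≤ 2) (hτ : δ ^ 2 = 2 - 2 * dot x y) :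
    2 / (sphereArea n * (1 + 4 * Real.cosh 2 ^ 2) ^ ((n : ℝ) / 2) * 2 ^ (1 + a)) *
      δ ^ (1 - (n : ℝ) - a) ≤ ∫ t in Set.Ioi 0, kernelIntegrand n a (dot x y) t := by
  have hω := sphereArea_pos hn
  have hτ1 := dot_le_one x y
  have hint := (integral_kernelIntegrand_le hn ha ha1 hδ hδ2 hτ).1
  have hM : 0 < (1 + 4 * Real.cosh 2 ^ 2) ^ ((n : ℝ) / 2) := by positivity
  have hsub : Set.Ioc δ (2 * δ) ⊆ Set.Ioi 0 := fun t ht => hδ.trans ht.1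
  set c := 2 * δ / ((1 + 4 * Real.cosh 2 ^ 2) ^ ((n : ℝ) / 2) * δ ^ (n : ℝ)) / sphereArea n /
    (2 * δ) ^ (1 + a) with hc
  have h1 : ∀ t ∈ Set.Ioc δ (2 * δ), c ≤ kernelIntegrand n a (dot x y) t := by
    intro t ht
    have ht0 : 0 < t := hsub ht
    have h2 := le_sphereArea_mul_heat hn hδ hδ2 hτ ht.1.le ht.2
    have h3 : 2 * δ / ((1 + 4 * Real.cosh 2 ^ 2) ^ ((n : ℝ) / 2) * δ ^ (n : ℝ)) / sphereArea n ≤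
        heat n t (dot x y) := by
      rw [div_le_iff₀ hω]; linarith
    have h4 : t ^ (1 + a) ≤ (2 * δ) ^ (1 + a) := Real.rpow_le_rpow ht0.le ht.2 (by linarith)
    change _ ≤ heat n t (dot x y) / t ^ (1 + a)
    exact div_le_div₀ (heat_nonneg hn ht0 hτ1) h3 (by positivity) h4
  calc _ = ∫ _t in Set.Ioc δ (2 * δ), c := by
        rw [setIntegral_const, measureReal_def, Real.volume_Ioc,
          ENNReal.toReal_ofReal (by linarith), smul_eq_mul, hc, Real.mul_rpow two_pos.le hδ.le,
          Real.rpow_sub hδ, Real.rpow_sub hδ, Real.rpow_add hδ 1 a, Real.rpow_one]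
        field_simp
        ring
    _ ≤ ∫ t in Set.Ioc δ (2 * δ), kernelIntegrand n a (dot x y) t :=
        setIntegral_mono_on (by simp) (hint.mono_set hsub) measurableSet_Ioc h1
    _ ≤ _ := by
        refine setIntegral_mono_set hint ?_ hsub.eventuallyLE
        filter_upwards [ae_restrict_mem measurableSet_Ioi] with t ht
        exact kernelIntegrand_nonneg hn a ht hτ1

/-- The kernel integral is comparable with a power of the chordal distance. -/
theorem exists_integral_kernelIntegrand_bounds (hn : 3 ≤ n) {a : ℝ} (ha : -1 < a) (ha1 : a < 1) :
    ∃ c C : ℝ, 0 < c ∧ 0 < C ∧ ∀ x y : Sph n, x ≠ y →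
      IntegrableOn (kernelIntegrand n a (dot x y)) (Set.Ioi 0) ∧
      c * ‖(x : EuclideanSpace ℝ (Fin n)) - y‖ ^ (1 - (n : ℝ) - a) ≤
        ∫ t in Set.Ioi 0, kernelIntegrand n a (dot x y) t ∧
      ∫ t in Set.Ioi 0, kernelIntegrand n a (dot x y) t ≤
        C * ‖(x : EuclideanSpace ℝ (Fin n)) - y‖ ^ (1 - (n : ℝ) - a) := by
  have hω := sphereArea_pos hn
  have hn' : (3 : ℝ) ≤ n := by exact_mod_cast hn
  have p0 : 0 < 1 - a := by linarith
  have p1 : 0 < (n : ℝ) - 1 + a := by linarith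
  have p2 : 0 < (n : ℝ) - 2 + a := by linarith
  refine ⟨2 / (sphereArea n * (1 + 4 * Real.cosh 2 ^ 2) ^ ((n : ℝ) / 2) * 2 ^ (1 + a)),
    2 * Real.cosh 2 / sphereArea n / (1 - a) +
      (sphereArea n)⁻¹ * (2 / (n - 1 + a) + 2 / (n - 2 + a)), by positivity, by positivity,
    fun x y hxy => ?_⟩
  have hδ : 0 < ‖(x : EuclideanSpace ℝ (Fin n)) - y‖ :=
    norm_sub_pos_iff.2 fun h => hxy (Subtype.ext h)
  have hδ2 : ‖(x : EuclideanSpace ℝ (Fin n)) - y‖ ≤ 2 := by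
    refine (norm_sub_le _ _).trans_eq ?_
    simp
    norm_num
  obtain ⟨h1, h2⟩ := integral_kernelIntegrand_le hn ha ha1 hδ hδ2 (norm_sub_sq_eq x y)
  exact ⟨h1, le_integral_kernelIntegrand hn ha ha1 hδ hδ2 (norm_sub_sq_eq x y), h2⟩

/-- The chord is 2 sin(d/2) with d the geodesic distance; the lower bound is Jordan's inequality. -/
theorem norm_sub_le_geoDist (x y : Sph n) :
    ‖(x : EuclideanSpace ℝ (Fin n)) - y‖ ≤ geoDist x y ∧
      2 / Real.pi * geoDist x y ≤ ‖(x : EuclideanSpace ℝ (Fin n)) - y‖ := by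
  have h0 : 0 ≤ geoDist x y := Real.arccos_nonneg _
  have hpi : geoDist x y ≤ Real.pi := Real.arccos_le_pi _
  have hcos : Real.cos (geoDist x y) = dot x y :=
    Real.cos_arccos (neg_one_le_dot x y) (dot_le_one x y)
  have hs : 0 ≤ Real.sin (geoDist x y / 2) :=
    Real.sin_nonneg_of_nonneg_of_le_pi (by linarith) (by linarith)
  have h : ‖(x : EuclideanSpace ℝ (Fin n)) - y‖ = 2 * Real.sin (geoDist x y / 2) := by
    refine (sq_eq_sq₀ (norm_nonneg _) (by positivity)).1 ?_
    rw [norm_sub_sq_eq, ← hcos]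
    have e := Real.cos_two_mul (geoDist x y / 2)
    rw [mul_div_cancel₀ _ two_ne_zero] at e
    have e2 := Real.sin_sq_add_cos_sq (geoDist x y / 2)
    rw [e]; linear_combination (-4) * e2
  rw [h]
  constructor
  · linarith [Real.sin_le (by linarith : 0 ≤ geoDist x y / 2)]
  · linarith [Real.mul_le_sin (by linarith : 0 ≤ geoDist x y / 2) (by linarith)]

theorem abs_Gamma_neg {a : ℝ} (ha : 0 < a) (ha1 : a < 1) :
    |Real.Gamma (-a)| = Real.Gamma (1 - a) / a := by
  have h1 := Real.Gamma_add_one (neg_ne_zero.2 ha.ne')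
  have h2 : 0 < Real.Gamma (1 - a) := Real.Gamma_pos_of_pos (by linarith)
  rw [neg_add_eq_sub] at h1
  have h3 : Real.Gamma (-a) = -(Real.Gamma (1 - a) / a) := by
    rw [h1]; field_simp
  rw [h3, abs_neg, abs_of_pos (by positivity)]

theorem abs_Gamma_neg_pos {a : ℝ} (ha : 0 < a) (ha1 : a < 1) : 0 < |Real.Gamma (-a)| := by
  rw [abs_Gamma_neg ha ha1]
  have : 0 < Real.Gamma (1 - a) := Real.Gamma_pos_of_pos (by linarith)
  positivity

theorem kernelL_bounds (hn : 3 ≤ n) {a : ℝ} (ha : 0 < a) (ha1 : a < 1) :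
    ∃ c C : ℝ, 0 < c ∧ 0 < C ∧ ∀ x y : Sph n, x ≠ y →
      IntegrableOn (kernelIntegrand n a (dot x y)) (Set.Ioi 0) ∧
      c / geoDist x y ^ (((n : ℝ) - 1) + a) ≤ kernelL n a (dot x y) ∧
      kernelL n a (dot x y) ≤ C / geoDist x y ^ (((n : ℝ) - 1) + a) := by
  obtain ⟨c, C, hc, hC, h⟩ := exists_integral_kernelIntegrand_bounds hn
    (by linarith : -1 < a) ha1
  have hΓ := abs_Gamma_neg_pos ha ha1
  have hpi := Real.pi_pos
  refine ⟨1 / |Real.Gamma (-a)| * c,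
    1 / |Real.Gamma (-a)| * (C * ((2 / Real.pi) ^ (((n : ℝ) - 1) + a))⁻¹), by positivity,
    by positivity, fun x y hxy => ?_⟩
  obtain ⟨h1, h2, h3⟩ := h x y hxy
  obtain ⟨g1, g2⟩ := norm_sub_le_geoDist x y
  have hn' : (3 : ℝ) ≤ n := by exact_mod_cast hn
  have hδ : 0 < ‖(x : EuclideanSpace ℝ (Fin n)) - y‖ :=
    norm_sub_pos_iff.2 fun h => hxy (Subtype.ext h)
  have hd : 0 < geoDist x y := hδ.trans_le g1
  have e : ‖(x : EuclideanSpace ℝ (Fin n)) - y‖ ^ (1 - (n : ℝ) - a) =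
      (‖(x : EuclideanSpace ℝ (Fin n)) - y‖ ^ (((n : ℝ) - 1) + a))⁻¹ := by
    rw [← Real.rpow_neg hδ.le]; ring_nf
  rw [e] at h2 h3
  have e1 : ‖(x : EuclideanSpace ℝ (Fin n)) - y‖ ^ (((n : ℝ) - 1) + a) ≤
      geoDist x y ^ (((n : ℝ) - 1) + a) := Real.rpow_le_rpow hδ.le g1 (by linarith)
  have e2 : (2 / Real.pi) ^ (((n : ℝ) - 1) + a) * geoDist x y ^ (((n : ℝ) - 1) + a) ≤
      ‖(x : EuclideanSpace ℝ (Fin n)) - y‖ ^ (((n : ℝ) - 1) + a) := by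
    rw [← Real.mul_rpow (by positivity) hd.le]
    exact Real.rpow_le_rpow (by positivity) g2 (by linarith)
  refine ⟨h1, ?_, ?_⟩
  · rw [mul_div_assoc, kernelL]
    refine mul_le_mul_of_nonneg_left (le_trans ?_ h2) (by positivity)
    rw [div_eq_mul_inv]
    gcongr
  · rw [mul_div_assoc, kernelL]
    refine mul_le_mul_of_nonneg_left (h3.trans ?_) (by positivity)
    rw [mul_div_assoc, div_eq_mul_inv, ← mul_inv]
    gcongr

end KernelBounds

/-! ### The subordination formula -/

section FractionalPower

theorem one_sub_exp_nonneg {l t : ℝ} (hl : 0 < l) (ht : 0 < t) : 0 ≤ 1 - Real.exp (-l * t) := by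
  have : Real.exp (-l * t) ≤ 1 := Real.exp_le_one_iff.2 (by nlinarith)
  linarith

theorem integrableOn_one_sub_exp_div {a l : ℝ} (ha : 0 < a) (ha1 : a < 1) (hl : 0 < l) :
    IntegrableOn (fun t : ℝ => (1 - Real.exp (-l * t)) / t ^ (1 + a)) (Set.Ioi 0) := by
  have hmeas : Measurable fun t : ℝ => (1 - Real.exp (-l * t)) / t ^ (1 + a) := by fun_prop
  have hsplit : Set.Ioc 0 1 ∪ Set.Ioi 1 = Set.Ioi (0 : ℝ) := Set.Ioc_union_Ioi_eq_Ioi zero_le_one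
  rw [← hsplit]
  refine IntegrableOn.union ?_ ?_
  · refine Integrable.mono' ((integrableOn_rpow_Ioc (by linarith : -1 < -a) zero_le_one).const_mul l)
      hmeas.aestronglyMeasurable ?_
    filter_upwards [ae_restrict_mem measurableSet_Ioc] with t ht
    have ht0 : 0 < t := ht.1
    rw [Real.norm_of_nonneg (div_nonneg (one_sub_exp_nonneg hl ht0) (Real.rpow_nonneg ht0.le _)),
      div_le_iff₀ (Real.rpow_pos_of_pos ht0 _), mul_assoc, ← Real.rpow_add ht0]
    simp only [neg_add_cancel_comm_assoc, Real.rpow_one]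
    linarith [Real.add_one_le_exp (-l * t)]
  · refine Integrable.mono' (integrableOn_Ioi_rpow_of_lt (by linarith : -(1 + a) < -1) one_pos)
      hmeas.aestronglyMeasurable ?_
    filter_upwards [ae_restrict_mem measurableSet_Ioi] with t ht
    have ht0 : 0 < t := one_pos.trans ht
    rw [Real.norm_of_nonneg (div_nonneg (one_sub_exp_nonneg hl ht0) (Real.rpow_nonneg ht0.le _)),
      Real.rpow_neg ht0.le, div_eq_mul_inv]
    exact mul_le_of_le_one_left (by positivity) (by linarith [Real.exp_pos (-l * t)])

/-- The subordination formula for fractional powers. -/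
theorem integral_one_sub_exp_div {a l : ℝ} (ha : 0 < a) (ha1 : a < 1) (hl : 0 < l) :
    ∫ t in Set.Ioi (0 : ℝ), (1 - Real.exp (-l * t)) / t ^ (1 + a) =
      l ^ a * |Real.Gamma (-a)| := by
  -- Integration by parts against -t^{-a}/a. The boundary terms vanish at 0 because 1 - e^{-lt} ≤ lt
  -- and a < 1, at infinity because a > 0. What remains is (l/a) ∫ t^{-a} e^{-lt} dt = l^a Γ(1-a)/a.
  have hparts := integral_Ioi_mul_deriv_eq_deriv_mul (a := 0) (a' := (0 : ℝ)) (b' := (0 : ℝ))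
    (u := fun t => 1 - Real.exp (-l * t)) (u' := fun t => l * Real.exp (-l * t))
    (v := fun t => -(t ^ (-a) / a)) (v' := fun t => t ^ (-a - 1))
    (fun t _ => by
      have he : HasDerivAt (fun t => Real.exp (-l * t)) (Real.exp (-l * t) * (-l)) t := by
        simpa using ((hasDerivAt_id t).const_mul (-l)).exp
      exact (he.const_sub 1).congr_deriv (by ring))
    (fun t ht => (((Real.hasDerivAt_rpow_const (p := -a) (Or.inl (ne_of_gt ht))).div_const
      a).neg).congr_deriv (by field_simp))
    ?_ ?_ ?_ ?_
  · have hG := Real.integral_rpow_mul_exp_neg_mul_Ioi (a := 1 - a) (r := l) (by linarith) hl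
    have e1 : ∫ t in Set.Ioi (0 : ℝ), (1 - Real.exp (-l * t)) / t ^ (1 + a) =
        ∫ t in Set.Ioi (0 : ℝ), (1 - Real.exp (-l * t)) * t ^ (-a - 1) := by
      refine setIntegral_congr_fun measurableSet_Ioi fun t ht => ?_
      rw [show -a - 1 = -(1 + a) by ring, Real.rpow_neg (le_of_lt ht), div_eq_mul_inv]
    have e2 : ∫ t in Set.Ioi (0 : ℝ), l * Real.exp (-l * t) * (-(t ^ (-a) / a)) =
        -(l / a) * ∫ t in Set.Ioi (0 : ℝ), t ^ (1 - a - 1) * Real.exp (-(l * t)) := by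
      rw [← integral_const_mul]
      refine integral_congr_ae (.of_forall fun t => ?_)
      change l * Real.exp (-l * t) * (-(t ^ (-a) / a)) =
        -(l / a) * (t ^ (1 - a - 1) * Real.exp (-(l * t)))
      rw [show 1 - a - 1 = -a by ring, neg_mul]
      ring
    rw [e1, hparts, e2, hG, abs_Gamma_neg ha ha1, one_div, Real.inv_rpow hl.le, ← Real.rpow_neg hl.le,
      show l ^ a = l * l ^ (-(1 - a)) by rw [← Real.rpow_one_add' hl.le (by linarith)]; ring_nf]
    ring
  · refine (integrableOn_one_sub_exp_div ha ha1 hl).congr_fun (fun t ht => ?_) measurableSet_Ioi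
    change (1 - Real.exp (-l * t)) / t ^ (1 + a) = (1 - Real.exp (-l * t)) * t ^ (-a - 1)
    rw [show -a - 1 = -(1 + a) by ring, Real.rpow_neg (le_of_lt ht), div_eq_mul_inv]
  · have h := (integrableOn_rpow_mul_exp_neg_mul_rpow (by linarith : -1 < -a) one_pos hl).const_mul
      (-(l / a))
    refine IntegrableOn.congr_fun h (fun t ht => ?_) measurableSet_Ioi
    change -(l / a) * (t ^ (-a) * Real.exp (-l * t ^ (1 : ℝ))) =
      l * Real.exp (-l * t) * (-(t ^ (-a) / a))
    rw [Real.rpow_one]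
    ring
  · have hz : Tendsto (fun t : ℝ => l / a * t ^ (1 - a)) (𝓝[>] 0) (𝓝 0) := by
      have h1 : Tendsto (fun t : ℝ => t ^ (1 - a)) (𝓝 0) (𝓝 (0 ^ (1 - a))) :=
        (Real.continuousAt_rpow_const 0 (1 - a) (Or.inr (by linarith))).tendsto
      rw [Real.zero_rpow (by linarith)] at h1
      simpa using (h1.mono_left nhdsWithin_le_nhds).const_mul (l / a)
    refine squeeze_zero_norm' ?_ hz
    filter_upwards [self_mem_nhdsWithin] with t ht
    have ht0 : 0 < t := ht
    change |(1 - Real.exp (-l * t)) * (-(t ^ (-a) / a))| ≤ _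
    have hp := Real.rpow_pos_of_pos ht0 (-a)
    rw [mul_neg, abs_neg, abs_of_nonneg (mul_nonneg (one_sub_exp_nonneg hl ht0) (by positivity)),
      show 1 - a = 1 + -a by ring, Real.rpow_add ht0, Real.rpow_one]
    calc (1 - Real.exp (-l * t)) * (t ^ (-a) / a) ≤ (l * t) * (t ^ (-a) / a) := by
          gcongr
          linarith [Real.add_one_le_exp (-l * t)]
      _ = _ := by ring
  · have hz : Tendsto (fun t : ℝ => t ^ (-a) / a) atTop (𝓝 0) := by
      simpa using (tendsto_rpow_neg_atTop ha).div_const a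
    refine squeeze_zero_norm' ?_ hz
    filter_upwards [eventually_gt_atTop 0] with t ht0
    change |(1 - Real.exp (-l * t)) * (-(t ^ (-a) / a))| ≤ _
    have hp := Real.rpow_pos_of_pos ht0 (-a)
    rw [mul_neg, abs_neg, abs_of_nonneg (mul_nonneg (one_sub_exp_nonneg hl ht0) (by positivity))]
    exact mul_le_of_le_one_left (by positivity) (by linarith [Real.exp_pos (-l * t)])

end FractionalPower

/-! ### The singular integral representation -/

section Representation

variable {n : ℕ}

theorem aestronglyMeasurable_prod {F : ℝ × Sph n → ℝ}
    (hF : ContinuousOn F (Set.Ioi 0 ×ˢ Set.univ)) :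
    AEStronglyMeasurable F ((volume.restrict (Set.Ioi 0)).prod (surf n)) := by
  have h := hF.aestronglyMeasurable (μ := (volume : Measure ℝ).prod (surf n))
    (measurableSet_Ioi.prod MeasurableSet.univ)
  rwa [← Measure.prod_restrict, Measure.restrict_univ] at h

/-- The kernel with a negative exponent is integrable over the sphere. -/
theorem integrable_integral_kernelIntegrand (hn : 3 ≤ n) {b : ℝ} (hb : b < 0) (x : Sph n) :
    Integrable (fun y => ∫ t in Set.Ioi 0, kernelIntegrand n b (dot x y) t) (surf n) := by
  have hm := halfDim_pos hn
  have hint : Integrable (fun q : ℝ × Sph n => kernelIntegrand n b (dot x q.2) q.1)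
      ((volume.restrict (Set.Ioi 0)).prod (surf n)) := by
    rw [integrable_prod_iff (aestronglyMeasurable_prod (continuousOn_kernelIntegrand b x))]
    constructor
    · filter_upwards [ae_restrict_mem measurableSet_Ioi] with t ht
      exact integrable_of_continuous (continuous_slice (continuousOn_kernelIntegrand b x) ht)
    -- Integrating over the sphere first leaves t^{-1-b} e^{-mt}, integrable at 0 exactly because b
    -- < 0.
    · have h := integrableOn_rpow_mul_exp_neg_mul_rpow (by linarith : -1 < -(1 + b)) one_pos hm
      refine IntegrableOn.congr_fun h (fun t ht => ?_) measurableSet_Ioi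
      have ht0 : 0 < t := ht
      change t ^ (-(1 + b)) * Real.exp (-halfDim n * t ^ (1 : ℝ)) =
        ∫ y, ‖kernelIntegrand n b (dot x y) t‖ ∂(surf n)
      simp only [Real.norm_of_nonneg (kernelIntegrand_nonneg hn b ht0 (dot_le_one x _))]
      change _ = ∫ y, heat n t (dot x y) / t ^ (1 + b) ∂(surf n)
      rw [integral_div, integral_heat hn x ht0, Real.rpow_one, Real.rpow_neg ht0.le]
      ring
  exact hint.integral_prod_right

/-- Absolute convergence of the double integral in the singular integral representation. -/
theorem integrable_sub_mul_kernelIntegrand (hn : 3 ≤ n) {a : ℝ} (ha : 0 < a) (ha1 : a < 1)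
    {u : Sph n → ℝ} (hu : Continuous u) (x : Sph n) {K : ℝ}
    (hK : ∀ y, |u x - u y| ≤ K * ‖(x : EuclideanSpace ℝ (Fin n)) - y‖) :
    Integrable (fun q : ℝ × Sph n => (u x - u q.2) * kernelIntegrand n a (dot x q.2) q.1)
      ((volume.restrict (Set.Ioi 0)).prod (surf n)) := by
  obtain ⟨_, C, _, hC, hup⟩ := exists_integral_kernelIntegrand_bounds hn (by linarith : -1 < a) ha1
  obtain ⟨c, _, hc, _, hlow⟩ := exists_integral_kernelIntegrand_bounds hn
    (by linarith : -1 < a - 1) (by linarith)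
  have hcont : ContinuousOn
      (fun q : ℝ × Sph n => (u x - u q.2) * kernelIntegrand n a (dot x q.2) q.1)
      (Set.Ioi 0 ×ˢ Set.univ) :=
    ContinuousOn.mul (by fun_prop) (continuousOn_kernelIntegrand a x)
  have hmeas := aestronglyMeasurable_prod hcont
  rw [integrable_prod_iff' hmeas]
  refine ⟨.of_forall fun y => ?_, ?_⟩
  · rcases eq_or_ne x y with rfl | hxy
    · simp
    · exact (hup x y hxy).1.const_mul (u x - u y)
  -- The Lipschitz factor Kδ times C δ^{1-n-a} is KC δ^{1-n-(a-1)}, at most KC/c times the kernel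
  -- integral with exponent a - 1.
  · refine Integrable.mono' ((integrable_integral_kernelIntegrand hn
      (by linarith : a - 1 < 0) x).const_mul (K * C / c)) hmeas.norm.prod_swap.integral_prod_right'
      (.of_forall fun y => ?_)
    have hnn : ∀ b, 0 ≤ ∫ t in Set.Ioi 0, kernelIntegrand n b (dot x y) t := fun b =>
      setIntegral_nonneg measurableSet_Ioi fun t ht =>
        kernelIntegrand_nonneg hn b ht (dot_le_one x y)
    have e : ∫ t in Set.Ioi 0, ‖(u x - u y) * kernelIntegrand n a (dot x y) t‖ =
        |u x - u y| * ∫ t in Set.Ioi 0, kernelIntegrand n a (dot x y) t := by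
      rw [← integral_const_mul]
      refine setIntegral_congr_fun measurableSet_Ioi fun t ht => ?_
      rw [norm_mul, Real.norm_eq_abs,
        Real.norm_of_nonneg (kernelIntegrand_nonneg hn a ht (dot_le_one x y))]
    rw [Real.norm_of_nonneg (integral_nonneg fun t => norm_nonneg _)]
    change ∫ t in Set.Ioi 0, ‖(u x - u y) * kernelIntegrand n a (dot x y) t‖ ≤ _
    rw [e]
    rcases eq_or_ne x y with rfl | hxy
    -- At y = x the left side is zero, but the majorant needs K ≥ 0; the estimate at the antipode of
    -- x supplies it.
    · have hKx : 0 ≤ K := by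
        obtain ⟨z, hz⟩ : ∃ z : Sph n, 0 < ‖(x : EuclideanSpace ℝ (Fin n)) - z‖ := by
          refine ⟨⟨-x, by simp⟩, ?_⟩
          have h2 := ne_zero_of_mem_unit_sphere x
          simpa [sub_neg_eq_add, ← two_smul ℝ] using h2
        exact nonneg_of_mul_nonneg_left ((abs_nonneg _).trans (hK z)) hz
      rw [sub_self, abs_zero, zero_mul]
      have := hnn (a - 1)
      positivity
    · have hδ : 0 < ‖(x : EuclideanSpace ℝ (Fin n)) - y‖ :=
        norm_sub_pos_iff.2 fun h => hxy (Subtype.ext h)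
      have h1 := (hup x y hxy).2.2
      have h2 := (hlow x y hxy).2.1
      have hKx : 0 ≤ K := nonneg_of_mul_nonneg_left ((abs_nonneg _).trans (hK y)) hδ
      set δ := ‖(x : EuclideanSpace ℝ (Fin n)) - y‖ with hδdef
      have e2 : δ ^ (1 - (n : ℝ) - (a - 1)) = δ ^ (1 - (n : ℝ) - a) * δ := by
        rw [← Real.rpow_add_one hδ.ne']; ring_nf
      rw [e2] at h2
      calc |u x - u y| * ∫ t in Set.Ioi 0, kernelIntegrand n a (dot x y) t
          ≤ (K * δ) * (C * δ ^ (1 - (n : ℝ) - a)) :=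
            mul_le_mul (hK y) h1 (hnn a) (by positivity)
        _ = K * C / c * (c * (δ ^ (1 - (n : ℝ) - a) * δ)) := by field_simp
        _ ≤ _ := mul_le_mul_of_nonneg_left h2 (by positivity)

theorem add_halfDim_rpow_le (hn : 3 ≤ n) {a : ℝ} (ha : 0 < a) (ha1 : a < 1) (k : ℕ) :
    ((k : ℝ) + halfDim n) ^ a ≤ (1 + halfDim n) * ((k : ℝ) + 1) := by
  have hm := halfDim_pos hn
  have hk := Nat.cast_nonneg (α := ℝ) k
  calc ((k : ℝ) + halfDim n) ^ a ≤ ((1 + halfDim n) * ((k : ℝ) + 1)) ^ a :=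
        Real.rpow_le_rpow (by positivity) (by nlinarith) ha.le
    _ ≤ ((1 + halfDim n) * ((k : ℝ) + 1)) ^ (1 : ℝ) :=
        Real.rpow_le_rpow_of_exponent_le (by nlinarith) ha1.le
    _ = _ := Real.rpow_one _

/-- As a < 1, the weight grows at most like k + 1, and the components decay like (k+1)^{-3}. -/
theorem SHBasis.summable_abs_dtnTerm (B : SHBasis n) (hn : 3 ≤ n) {a : ℝ} (ha : 0 < a)
    (ha1 : a < 1) {f : EuclideanSpace ℝ (Fin n) → ℝ} (hf : SmoothNear f) (x : Sph n) :
    Summable fun k : ℕ => |B.dtnTerm a (fun y => f y) x k| := by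
  obtain ⟨D, hD, h⟩ := B.exists_abs_proj_le_div hn hf
  have hm := halfDim_pos hn
  refine Summable.of_nonneg_of_le (fun k => abs_nonneg _) (fun k => ?_)
    (summable_div_add_one_pow ((1 + halfDim n) * D) (j := 2) le_rfl)
  have hk := Nat.cast_nonneg (α := ℝ) k
  rw [SHBasis.dtnTerm, abs_mul, abs_of_nonneg (Real.rpow_nonneg (by positivity) _)]
  calc _ ≤ ((1 + halfDim n) * ((k : ℝ) + 1)) * (D / ((k : ℝ) + 1) ^ 3) :=
        mul_le_mul (add_halfDim_rpow_le hn ha ha1 k) (h k x) (abs_nonneg _) (by positivity)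
    _ = _ := by field_simp

/-- The fractional power as an integral of the semigroup. -/
theorem SHBasis.integral_sub_integral_heat (B : SHBasis n) (hn : 3 ≤ n) {a : ℝ} (ha : 0 < a)
    (ha1 : a < 1) {f : EuclideanSpace ℝ (Fin n) → ℝ} (hf : SmoothNear f) (x : Sph n) :
    ∫ t in Set.Ioi (0 : ℝ), (f x - ∫ y : Sph n, f y * heat n t (dot x y) ∂(surf n)) / t ^ (1 + a) =
      |Real.Gamma (-a)| * B.fracDtN a (fun y => f y) x := by
  have hm := halfDim_pos hn
  have hl : ∀ k : ℕ, 0 < (k : ℝ) + halfDim n := fun k => by positivity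
  have hsum := B.summable_abs_dtnTerm hn ha ha1 hf x
  -- Sum and integral may be exchanged: by the subordination formula the L¹ norms of the terms are
  -- |Γ(-a)| times the absolute values of the terms of the fractional power.
  have h1 := hasSum_integral_of_summable_integral_norm (μ := volume.restrict (Set.Ioi (0 : ℝ)))
    (F := fun (k : ℕ) t => (1 - Real.exp (-((k : ℝ) + halfDim n) * t)) / t ^ (1 + a) *
      B.proj k (fun y => f y) x)
    (fun k => (integrableOn_one_sub_exp_div ha ha1 (hl k)).mul_const _) (by
      refine (hsum.mul_left |Real.Gamma (-a)|).congr fun k => ?_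
      have e : ∫ t in Set.Ioi (0 : ℝ), ‖(1 - Real.exp (-((k : ℝ) + halfDim n) * t)) / t ^ (1 + a) *
          B.proj k (fun y => f y) x‖ =
          ∫ t in Set.Ioi (0 : ℝ), (1 - Real.exp (-((k : ℝ) + halfDim n) * t)) / t ^ (1 + a) *
            |B.proj k (fun y => f y) x| := by
        refine setIntegral_congr_fun measurableSet_Ioi fun t ht => ?_
        rw [norm_mul, Real.norm_eq_abs (B.proj k _ x), Real.norm_of_nonneg
          (div_nonneg (one_sub_exp_nonneg (hl k) ht) (Real.rpow_nonneg (le_of_lt ht) _))]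
      rw [e, integral_mul_const, integral_one_sub_exp_div ha ha1 (hl k), SHBasis.dtnTerm, abs_mul,
        abs_of_nonneg (Real.rpow_nonneg (hl k).le _)]
      ring)
  simp only [integral_mul_const, integral_one_sub_exp_div ha ha1 (hl _)] at h1
  have h2 : (∫ t in Set.Ioi (0 : ℝ), ∑' k : ℕ,
      (1 - Real.exp (-((k : ℝ) + halfDim n) * t)) / t ^ (1 + a) * B.proj k (fun y => f y) x) =
      ∫ t in Set.Ioi (0 : ℝ),
        (f x - ∫ y : Sph n, f y * heat n t (dot x y) ∂(surf n)) / t ^ (1 + a) := by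
    refine setIntegral_congr_fun measurableSet_Ioi fun t ht => ?_
    have h3 := ((B.hasSum_proj hn hf x).sub (B.hasSum_integral_mul_heat hn hf x ht)).div_const
      (t ^ (1 + a))
    change ∑' k : ℕ, _ = _
    rw [← h3.tsum_eq]
    exact tsum_congr fun k => by ring
  rw [← h2, ← h1.tsum_eq, SHBasis.fracDtN, ← tsum_mul_left]
  refine tsum_congr fun k => ?_
  rw [SHBasis.dtnTerm]
  ring

/-- The singular integral representation of the fractional power. -/
theorem SHBasis.fracDtN_eq (B : SHBasis n) (hn : 3 ≤ n) {a : ℝ} (ha : 0 < a)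
    (ha1 : a < 1) {f : EuclideanSpace ℝ (Fin n) → ℝ} (hf : SmoothNear f) (x : Sph n) :
    Integrable (fun y : Sph n => (f x - f y) * kernelL n a (dot x y)) (surf n) ∧
      B.fracDtN a (fun y => f y) x =
        (∫ y : Sph n, (f x - f y) * kernelL n a (dot x y) ∂(surf n)) + halfDim n ^ a * f x := by
  have hm := halfDim_pos hn
  have hΓ := abs_Gamma_neg_pos ha ha1
  obtain ⟨K, -, hK⟩ := hf.exists_lipschitz_at x
  have hint := integrable_sub_mul_kernelIntegrand hn ha ha1 hf.continuous x hK
  have e1 : ∀ y : Sph n, (f x - f y) * kernelL n a (dot x y) = 1 / |Real.Gamma (-a)| *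
      ∫ t in Set.Ioi 0, (f x - f y) * kernelIntegrand n a (dot x y) t := by
    intro y
    rw [integral_const_mul, kernelL]
    ring
  have hswap : ∫ t in Set.Ioi 0, ∫ y : Sph n, (f x - f y) * kernelIntegrand n a (dot x y) t
        ∂(surf n) =
      ∫ y : Sph n, (∫ t in Set.Ioi 0, (f x - f y) * kernelIntegrand n a (dot x y) t) ∂(surf n) :=
    integral_integral_swap hint
  -- The kernel has mass e^{-mt} rather than 1; the defect 1 - e^{-mt} is the source of the term m^a
  -- f(x).
  have hinner : ∀ t ∈ Set.Ioi (0 : ℝ),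
      (f x - ∫ y : Sph n, f y * heat n t (dot x y) ∂(surf n)) / t ^ (1 + a) =
      (∫ y : Sph n, (f x - f y) * kernelIntegrand n a (dot x y) t ∂(surf n)) +
        (1 - Real.exp (-halfDim n * t)) / t ^ (1 + a) * f x := by
    intro t ht
    have cH := continuous_heat_dot (n := n) ht x
    have h1 : ∀ y : Sph n, (f x - f y) * kernelIntegrand n a (dot x y) t =
        (f x * heat n t (dot x y) - f y * heat n t (dot x y)) / t ^ (1 + a) := by
      intro y
      change (f x - f y) * (heat n t (dot x y) / t ^ (1 + a)) = _
      ring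
    simp only [h1]
    rw [integral_div, integral_sub (integrable_mul_of_continuous (continuous_const (y := f x)) cH)
      (integrable_mul_of_continuous hf.continuous cH), integral_const_mul, integral_heat hn x ht]
    ring
  have hmain := B.integral_sub_integral_heat hn ha ha1 hf x
  rw [setIntegral_congr_fun measurableSet_Ioi hinner, integral_add hint.integral_prod_left
    ((integrableOn_one_sub_exp_div ha ha1 hm).mul_const _), hswap, integral_mul_const,
    integral_one_sub_exp_div ha ha1 hm] at hmain
  simp only [e1]
  refine ⟨hint.integral_prod_right.const_mul _, ?_⟩
  rw [integral_const_mul]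
  field_simp
  linarith

end Representation

end

end SphereDtN

theorem theorem6p3 (n : ℕ) (hn : 3 ≤ n) (s : ℝ) (hs0 : 0 < 2 * s) (hs1 : 2 * s < 1) :
    (∀ (B : SphereDtN.SHBasis n) (u : SphereDtN.Sph n → ℝ), SphereDtN.SmoothOnSphere u →
      ∀ x : SphereDtN.Sph n,
        Summable (fun k : ℕ => |B.dtnTerm (2 * s) u x k|) ∧
        MeasureTheory.Integrable
          (fun y => (u x - u y) * SphereDtN.kernelL n (2 * s) (SphereDtN.dot x y))
          (SphereDtN.surf n) ∧
        B.fracDtN (2 * s) u x =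
          (∫ y, (u x - u y) * SphereDtN.kernelL n (2 * s) (SphereDtN.dot x y) ∂(SphereDtN.surf n))
            + (((n : ℝ) - 2) / 2) ^ (2 * s) * u x) ∧
    (∃ c C : ℝ, 0 < c ∧ 0 < C ∧ ∀ x y : SphereDtN.Sph n, x ≠ y →
      MeasureTheory.IntegrableOn
        (SphereDtN.kernelIntegrand n (2 * s) (SphereDtN.dot x y)) (Set.Ioi 0) ∧
      c / SphereDtN.geoDist x y ^ (((n : ℝ) - 1) + 2 * s)
        ≤ SphereDtN.kernelL n (2 * s) (SphereDtN.dot x y) ∧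
      SphereDtN.kernelL n (2 * s) (SphereDtN.dot x y)
        ≤ C / SphereDtN.geoDist x y ^ (((n : ℝ) - 1) + 2 * s)) := by
  refine ⟨fun B u hu x => ?_, SphereDtN.kernelL_bounds hn hs0 hs1⟩
  -- The results for ambient functions apply to the radial extension, which restricts to u on the
  -- sphere.
  have hf := SphereDtN.smoothNear_radialExt hu
  have h1 := B.summable_abs_dtnTerm hn hs0 hs1 hf x
  have h2 := B.fracDtN_eq hn hs0 hs1 hf x
  simp only [SphereDtN.radialExt_coe] at h1 h2
  exact ⟨h1, h2⟩
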